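/- Let $l,h_1,h_2,\tau>0$, $0<k_1<\sqrt{h_1/h_2}$, $0<k_2<\sqrt{h_2/h_1}$, and let $X=L^2(0,l)\times L^2(0,l)$ with its Hilbert norm. Put $\mathcal L(f,g)=\big(-f'+h_1(g-f),\,-g'+h_2(f-g)\big)$ on $H^1(0,l)\times H^1(0,l)$, and let $\mathcal A$ (denoted $A-BKC_\Lambda$) be the restriction of $\mathcal L$ to $$D(\mathcal A)=\{(f,g)\in H^1(0,l)\times H^1(0,l):\ f(0)=-k_1g(l),\ g(0)=-k_2f(l)\}.$$ All evolution equations $\partial_t z=\mathcal Lz$, $z(t,0)=u(t)$ below are understood in the mild sense ($z$ continuous in time with values in $X$, $u\in L^2_{loc}$, the equation and the boundary condition holding after integration in time); values at $x=l$ are left Lebesgue values, i.e. $z(l)=\lim_{h\downarrow0}\frac1h\int_{l-h}^l z(x)\,dx$, and exist for almost every time. For initial values $\theta_0=(\theta_{10},\theta_{20})\in X$ and $\hat\theta_0=(\hat\theta_{10},\hat\theta_{20})\in X$, a *closed-loop trajectory* consists of: - the plant $\partial_t\theta=\mathcal L\theta$, $\theta(t,0)=u(t)$, $t>0$, $\theta(0)=\theta_0$,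 with delayed observation $y_1(t)=\theta_2(t-\tau,l)$, $y_2(t)=\theta_1(t-\tau,l)$ for $t>\tau$; - the observer $\partial_s\hat\theta^+=\mathcal L\hat\theta^+$, $s>0$, $\hat\theta^+(0)=\hat\theta_0$, with $\hat\theta^+_1(s,0)=-k_1[\hat\theta_2^+(s,l)-y_1(s+\tau)]+u_1(s)$ and $\hat\theta^+_2(s,0)=-k_2[\hat\theta_1^+(s,l)-y_2(s+\tau)]+u_2(s)$; - for each $t>\tau$ the predictor $\partial_s\hat\theta^-(s,t)=\mathcal L\hat\theta^-(s,t)$, $\hat\theta^-(s,t,0)=u(s)$, $t-\tau\le s\le t$, with $\hat\theta^-(t-\tau,t)=\hat\theta^+(t-\tau)$; - the control $u(t)=0$ for $0\le t\le\tau$, and $u_1(t)=-k_1\hat\theta_2^-(t,t,l)$, $u_2(t)=-k_2\hat\theta_1^-(t,t,l)$ for $t>\tau$. For $w\in X$, the *error system* consists of: the observer error $\partial_s\varepsilon^+=\mathcal L\varepsilon^+$, $s>0$, $\varepsilon^+(0)=w$, $\varepsilon^+_1(s,0)=-k_1\varepsilon_2^+(s,l)$, $\varepsilon^+_2(s,0)=-k_2\varepsilon_1^+(s,l)$;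 for each $t>\tau$ the prediction error $\partial_s\varepsilon^-(s,t)=\mathcal L\varepsilon^-(s,t)$, $\varepsilon^-(s,t,0)=0$, $t-\tau\le s\le t$, $\varepsilon^-(t-\tau,t)=\varepsilon^+(t-\tau)$; and, for $t>\tau$, $\partial_t\theta=\mathcal L\theta$ with $\theta_1(t,0)=-k_1\varepsilon_2^-(t,t,l)-k_1\theta_2(t,l)$, $\theta_2(t,0)=-k_2\varepsilon_1^-(t,t,l)-k_2\theta_1(t,l)$ and arbitrary state $\theta(\tau)\in X$. Then closed-loop trajectories exist for all $\theta_0,\hat\theta_0\in X$, and the error system has a solution for all $w,\theta(\tau)\in X$. The operator $\mathcal A$ generates a $C_0$-semigroup on $X$, and there are $M,\gamma_0>0$ with $\|e^{\mathcal At}\|\le Me^{-\gamma_0t}$ for all $t\ge0$. For every such pair $(M,\gamma_0)$: 1. If $\tau>l$, there is $D>0$ such that every closed-loop trajectory satisfies $\|\theta(t)\|\le De^{-\gamma_0t}\|\theta_0\|$ for all $t>\tau$, and there is $D>0$ such that every solution of the error system satisfies $\|\theta(t)\|\le De^{-\gamma_0t}\|\theta(\tau)\|$ for all $t>\tau$.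 2. If $0<\tau\le l$, then for every $\gamma<\gamma_0$ there are $D_\tau,C_\tau^0>0$, independent of $t$ and of the initial values, such that every closed-loop trajectory with $w=\hat\theta_0-\theta_0\in D(\mathcal A)$ satisfies $$\|\theta(t)\|\le D_\tau e^{-\gamma t}\big(\|\theta_0\|+C_\tau^0\,\|\mathcal Aw\|\big)\qquad\text{for all }t>\tau.$$ -/

import Mathlib

open MeasureTheory Set Filter Topology

noncomputable section

/-- The plane with its Euclidean norm. Index `0` is the first tube, index `1` the second one. -/
abbrev Plane : Type := EuclideanSpace ℝ (Fin 2)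

/-- The state space `L²(0,l) × L²(0,l)` with its Hilbert norm, as the space of square integrable
maps from `(0,l)` to the plane. -/
abbrev State (l : ℝ) : Type := Lp Plane 2 (volume.restrict (Ioo (0 : ℝ) l))

/-- The heat exchange matrix with rows `(-h₁, h₁)` and `(h₂, -h₂)`, as a linear map. -/
def exchange (h₁ h₂ : ℝ) : Plane →L[ℝ] Plane :=
  Matrix.toEuclideanCLM (𝕜 := ℝ) !![-h₁, h₁; h₂, -h₂]

lemma exchange_apply (h₁ h₂ : ℝ) (c : Plane) :
    exchange h₁ h₂ c = !₂[h₁ * (c 1 - c 0), h₂ * (c 0 - c 1)] := by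
  ext i
  rw [exchange, Matrix.ofLp_toEuclideanCLM]
  fin_cases i <;> simp [Matrix.mulVec, dotProduct, Fin.sum_univ_two] <;> ring

/-- `z` belongs to `H¹(0,l) × H¹(0,l)`, with absolutely continuous representative `f` on `[0,l]`
and with derivative `g ∈ L²(0,l) × L²(0,l)`. -/
structure IsH1 (l : ℝ) (z : State l) (f : ℝ → Plane) (g : State l) : Prop where
  rep : z =ᵐ[volume.restrict (Ioo (0 : ℝ) l)] f
  eq_integral : ∀ x ∈ Icc (0 : ℝ) l, f x = f 0 + ∫ s in (0 : ℝ)..x, g s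

/-- The differential operator of the heat exchanger on `H¹(0,l) × H¹(0,l)`, together with the
boundary values: `z` is in `H¹ × H¹`, `w = -z' + exchange z`, `z(0) = a` and `z(l) = b`. -/
def HeatOp (l h₁ h₂ : ℝ) (z w : State l) (a b : Plane) : Prop :=
  ∃ (f : ℝ → Plane) (g : State l), IsH1 l z f g ∧
    w = -g + (exchange h₁ h₂).compLp z ∧ f 0 = a ∧ f l = b

/-- The boundary feedback `(u₁, u₂) = (-k₁ c₂, -k₂ c₁)` from the boundary value `c` at `x = l`,
i.e. `u = -K y` with `K = diag(k₁, k₂)` and with the undelayed output `y = (c₂, c₁)`. -/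
def feedback (k₁ k₂ : ℝ) (c : Plane) : Plane := !₂[-k₁ * c 1, -k₂ * c 0]

/-- `c` is the value at `x = l` of the state `z`, in the sense of the extension (the Lebesgue
extension) of point evaluation from `H¹` to those `L²` functions whose left averages at `l`
converge. -/
def HasEndValue (l : ℝ) (z : State l) (c : Plane) : Prop :=
  Tendsto (fun h : ℝ => h⁻¹ • ∫ x in (l - h)..l, z x) (𝓝[>] 0) (𝓝 c)

/-- `z : [a,b] → L² × L²` is the mild solution of the heat exchanger equations
`∂ₜ z = -∂ₓ z + exchange z` on `(0,l)`, with boundary input `z(t,0) = u(t)`, `u ∈ L²(a,b)`, and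
with `z(a) = z₀`: it is continuous, and the equation and the boundary condition hold after
integration over `[a,t]`, for each `t`. -/
structure IsMildSolution (l h₁ h₂ a b : ℝ) (z₀ : State l) (u : ℝ → Plane) (z : ℝ → State l) :
    Prop where
  continuousOn : ContinuousOn z (Icc a b)
  initial : z a = z₀
  input : MemLp u 2 (volume.restrict (Ioc a b))
  equation : ∀ t ∈ Icc a b, ∃ c : Plane,
    HeatOp l h₁ h₂ (∫ s in a..t, z s) (z t - z₀) (∫ s in a..t, u s) c

/-- The closed loop of plant, delayed observation, observer, predictor and control law.
`θ` is the state of the plant, `u` the control, `y` the delayed observation,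
`θp` the state of the observer, and `θm s t` the state at time `s ∈ [t - τ, t]` of the predictor
that is started at time `t - τ`. -/
structure ClosedLoop (l h₁ h₂ k₁ k₂ τ : ℝ) (θ₀ θp₀ : State l) (θ : ℝ → State l)
    (u y : ℝ → Plane) (θp : ℝ → State l) (θm : ℝ → ℝ → State l) : Prop where
  plant : ∀ T, 0 ≤ T → IsMildSolution l h₁ h₂ 0 T θ₀ u θ
  observation : ∀ᵐ t : ℝ, τ < t →
    ∃ c, HasEndValue l (θ (t - τ)) c ∧ y t = !₂[c 1, c 0]
  observer : ∃ v : ℝ → Plane, (∀ T, 0 ≤ T → IsMildSolution l h₁ h₂ 0 T θp₀ v θp) ∧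
    ∀ᵐ s : ℝ, 0 < s → ∃ c, HasEndValue l (θp s) c ∧
      v s = !₂[-k₁ * (c 1 - y (s + τ) 0) + u s 0, -k₂ * (c 0 - y (s + τ) 1) + u s 1]
  predictor : ∀ t, τ < t →
    IsMildSolution l h₁ h₂ (t - τ) t (θp (t - τ)) u (fun s => θm s t)
  control_before : ∀ᵐ t : ℝ, 0 ≤ t → t ≤ τ → u t = 0
  control_after : ∀ᵐ t : ℝ, τ < t →
    ∃ c, HasEndValue l (θm t t) c ∧ u t = feedback k₁ k₂ c

/-- The closed loop for `t > τ` in terms of the state `θ`, the observer error `εp` with initial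
value `w`, and the predictor error `εm s t`, `s ∈ [t - τ, t]`. The state of the plant at time `τ`
is arbitrary. -/
structure ErrorSystem (l h₁ h₂ k₁ k₂ τ : ℝ) (w : State l) (θ εp : ℝ → State l)
    (εm : ℝ → ℝ → State l) : Prop where
  observerError : ∃ v : ℝ → Plane, (∀ T, 0 ≤ T → IsMildSolution l h₁ h₂ 0 T w v εp) ∧
    ∀ᵐ s : ℝ, 0 < s → ∃ c, HasEndValue l (εp s) c ∧ v s = feedback k₁ k₂ c
  predictorError : ∀ t, τ < t →
    IsMildSolution l h₁ h₂ (t - τ) t (εp (t - τ)) 0 (fun s => εm s t)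
  state : ∃ u : ℝ → Plane, (∀ T, τ ≤ T → IsMildSolution l h₁ h₂ τ T (θ τ) u θ) ∧
    ∀ᵐ t : ℝ, τ < t → ∃ c e, HasEndValue l (θ t) c ∧ HasEndValue l (εm t t) e ∧
      u t = feedback k₁ k₂ e + feedback k₁ k₂ c

lemma State.intervalIntegrable {l : ℝ} (g : State l) {x : ℝ} (hx : x ∈ Icc (0 : ℝ) l) :
    IntervalIntegrable g volume 0 x := by
  have h : IntegrableOn g (Ioo (0 : ℝ) l) volume := (Lp.memLp g).integrable (by norm_num)
  rw [intervalIntegrable_iff_integrableOn_Ioo_of_le hx.1]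
  exact h.mono_set (Ioo_subset_Ioo_right hx.2)

lemma State.integral_congr {l : ℝ} {g g' : ℝ → Plane}
    (h : g =ᵐ[volume.restrict (Ioo (0 : ℝ) l)] g') {x : ℝ} (hx : x ∈ Icc (0 : ℝ) l) :
    ∫ s in (0 : ℝ)..x, g s = ∫ s in (0 : ℝ)..x, g' s := by
  rw [intervalIntegral.integral_of_le hx.1, intervalIntegral.integral_of_le hx.1,
    integral_Ioc_eq_integral_Ioo, integral_Ioc_eq_integral_Ioo]
  exact integral_congr_ae (ae_restrict_of_ae_restrict_of_subset (Ioo_subset_Ioo_right hx.2) h)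

lemma IsH1.add {l : ℝ} {z z' : State l} {f f' : ℝ → Plane} {g g' : State l}
    (h : IsH1 l z f g) (h' : IsH1 l z' f' g') : IsH1 l (z + z') (f + f') (g + g') where
  rep := (Lp.coeFn_add z z').trans (h.rep.add h'.rep)
  eq_integral x hx := by
    rw [State.integral_congr (Lp.coeFn_add g g') hx]
    simp only [Pi.add_apply]
    rw [intervalIntegral.integral_add (g.intervalIntegrable hx) (g'.intervalIntegrable hx),
      h.eq_integral x hx, h'.eq_integral x hx]
    abel

lemma IsH1.smul {l : ℝ} (c : ℝ) {z : State l} {f : ℝ → Plane} {g : State l}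
    (h : IsH1 l z f g) : IsH1 l (c • z) (c • f) (c • g) where
  rep := (Lp.coeFn_smul c z).trans (h.rep.const_smul c)
  eq_integral x hx := by
    rw [State.integral_congr (Lp.coeFn_smul c g) hx]
    simp only [Pi.smul_apply]
    rw [intervalIntegral.integral_smul, h.eq_integral x hx, smul_add]

/-- The derivative of an `H¹` function is determined by the function. -/
lemma IsH1.eq_zero {l : ℝ} {f : ℝ → Plane} {g : State l} (h : IsH1 l 0 f g) : g = 0 := by
  rcases le_or_gt l 0 with hl | hl
  · rw [Lp.eq_zero_iff_ae_eq_zero]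
    filter_upwards [ae_restrict_mem measurableSet_Ioo] with x hx
    exact absurd (hx.1.trans hx.2) (not_lt.2 hl)
  have hf : ContinuousOn f (Icc 0 l) := by
    have hc : ContinuousOn (fun x => f 0 + ∫ s in (0 : ℝ)..x, g s) (Icc 0 l) := by
      refine continuousOn_const.add ?_
      have := intervalIntegral.continuousOn_primitive_interval'
        (g.intervalIntegrable (right_mem_Icc.2 hl.le)) (left_mem_uIcc)
      rwa [uIcc_of_le hl.le] at this
    exact hc.congr h.eq_integral
  have h0 : EqOn f 0 (Ioo 0 l) := by
    have h1 : f =ᵐ[volume.restrict (Ioo (0 : ℝ) l)] 0 := h.rep.symm.trans (Lp.coeFn_zero _ _ _)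
    exact Measure.eqOn_open_of_ae_eq h1 isOpen_Ioo (hf.mono Ioo_subset_Icc_self)
      continuousOn_const
  have hd := (g.intervalIntegrable (right_mem_Icc.2 hl.le)).ae_hasDerivAt_integral
  rw [Lp.eq_zero_iff_ae_eq_zero]
  filter_upwards [ae_restrict_mem measurableSet_Ioo, ae_restrict_of_ae hd] with x hx hdx
  have hxu : x ∈ uIcc 0 l := by rw [uIcc_of_le hl.le]; exact Ioo_subset_Icc_self hx
  have h2 := hdx hxu 0 left_mem_uIcc
  have h3 : HasDerivAt (fun y => ∫ s in (0 : ℝ)..y, g s) 0 x := by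
    refine (hasDerivAt_const x (-f 0)).congr_of_eventuallyEq ?_
    filter_upwards [isOpen_Ioo.mem_nhds hx] with y hy
    have h4 := h.eq_integral y (Ioo_subset_Icc_self hy)
    rw [h0 hy, Pi.zero_apply] at h4
    exact (neg_eq_of_add_eq_zero_right h4.symm).symm
  exact h2.unique h3

lemma feedback_add (k₁ k₂ : ℝ) (c d : Plane) :
    feedback k₁ k₂ (c + d) = feedback k₁ k₂ c + feedback k₁ k₂ d := by
  ext i; fin_cases i <;> simp [feedback] <;> ring

lemma feedback_smul (k₁ k₂ r : ℝ) (c : Plane) :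
    feedback k₁ k₂ (r • c) = r • feedback k₁ k₂ c := by
  ext i; fin_cases i <;> simp [feedback] <;> ring

lemma exchange_add (h₁ h₂ : ℝ) {l : ℝ} (z z' : State l) :
    (exchange h₁ h₂).compLp (z + z') = (exchange h₁ h₂).compLp z + (exchange h₁ h₂).compLp z' :=
  map_add ((exchange h₁ h₂).compLpL 2 (volume.restrict (Ioo (0 : ℝ) l))) z z'

lemma exchange_smul (h₁ h₂ : ℝ) {l : ℝ} (r : ℝ) (z : State l) :
    (exchange h₁ h₂).compLp (r • z) = r • (exchange h₁ h₂).compLp z :=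
  map_smul ((exchange h₁ h₂).compLpL 2 (volume.restrict (Ioo (0 : ℝ) l))) r z

lemma HeatOp.add {l h₁ h₂ : ℝ} {z w z' w' : State l} {a b a' b' : Plane}
    (h : HeatOp l h₁ h₂ z w a b) (h' : HeatOp l h₁ h₂ z' w' a' b') :
    HeatOp l h₁ h₂ (z + z') (w + w') (a + a') (b + b') := by
  obtain ⟨f, g, hf, hw, ha, hb⟩ := h
  obtain ⟨f', g', hf', hw', ha', hb'⟩ := h'
  refine ⟨f + f', g + g', hf.add hf', ?_, by simp [ha, ha'], by simp [hb, hb']⟩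
  rw [hw, hw', exchange_add]
  abel

lemma HeatOp.smul {l h₁ h₂ : ℝ} (r : ℝ) {z w : State l} {a b : Plane}
    (h : HeatOp l h₁ h₂ z w a b) : HeatOp l h₁ h₂ (r • z) (r • w) (r • a) (r • b) := by
  obtain ⟨f, g, hf, hw, ha, hb⟩ := h
  refine ⟨r • f, r • g, hf.smul r, ?_, by simp [ha], by simp [hb]⟩
  rw [hw, exchange_smul, smul_add, smul_neg]

lemma HeatOp.zero (l h₁ h₂ : ℝ) : HeatOp l h₁ h₂ 0 0 0 0 := by
  refine ⟨0, 0, ⟨Lp.coeFn_zero _ _ _, fun x hx => ?_⟩, ?_, rfl, rfl⟩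
  · rw [State.integral_congr (Lp.coeFn_zero _ _ _) hx]
    simp
  · have := exchange_smul h₁ h₂ 0 (0 : State l)
    rw [zero_smul, zero_smul] at this
    rw [this, neg_zero, add_zero]

/-- The graph of the operator of the undelayed feedback system: `w = -z' + exchange z` for
`z ∈ H¹ × H¹` with `z₁(0) = -k₁ z₂(l)` and `z₂(0) = -k₂ z₁(l)`. -/
def feedbackGraph (l h₁ h₂ k₁ k₂ : ℝ) : Submodule ℝ (State l × State l) where
  carrier := {p | ∃ c : Plane, HeatOp l h₁ h₂ p.1 p.2 (feedback k₁ k₂ c) c}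
  add_mem' := by
    rintro p q ⟨c, hc⟩ ⟨d, hd⟩
    exact ⟨c + d, by rw [feedback_add]; exact hc.add hd⟩
  zero_mem' := by
    refine ⟨0, ?_⟩
    have := feedback_smul k₁ k₂ 0 0
    rw [zero_smul, zero_smul] at this
    rw [this]
    exact HeatOp.zero l h₁ h₂
  smul_mem' := by
    rintro r p ⟨c, hc⟩
    exact ⟨r • c, by rw [feedback_smul]; exact hc.smul r⟩

/-- The operator `A - B K C_Λ` of the undelayed feedback system. -/
def feedbackOp (l h₁ h₂ k₁ k₂ : ℝ) : State l →ₗ.[ℝ] State l :=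
  (feedbackGraph l h₁ h₂ k₁ k₂).toLinearPMap

lemma feedbackOp_graph (l h₁ h₂ k₁ k₂ : ℝ) :
    (feedbackOp l h₁ h₂ k₁ k₂).graph = feedbackGraph l h₁ h₂ k₁ k₂ := by
  apply Submodule.toLinearPMap_graph_eq
  rintro ⟨z, w⟩ ⟨c, f, g, hf, hw, -, -⟩ hz
  have hz' : z = 0 := hz
  subst hz'
  have h0 : (exchange h₁ h₂).compLp (0 : State l) = 0 := by
    have := exchange_smul h₁ h₂ 0 (0 : State l)
    rwa [zero_smul, zero_smul] at this
  have hg := hf.eq_zero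
  have hw' : w = -g + (exchange h₁ h₂).compLp (0 : State l) := hw
  change w = 0
  rw [hw', hg, h0, neg_zero, add_zero]

/-- `S` is a strongly continuous semigroup of bounded operators (only times `t ≥ 0` matter). -/
structure IsC0Semigroup {X : Type*} [NormedAddCommGroup X] [NormedSpace ℝ X]
    (S : ℝ → X →L[ℝ] X) : Prop where
  zero : S 0 = 1
  add : ∀ s t, 0 ≤ s → 0 ≤ t → S (s + t) = S s * S t
  continuousOn : ∀ x, ContinuousOn (fun t => S t x) (Ici 0)

/-- `A` is the infinitesimal generator of `S`: `A x = y` if and only if `(S(t) x - x) / t → y`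
as `t` decreases to `0`. -/
def IsGenerator {X : Type*} [NormedAddCommGroup X] [NormedSpace ℝ X]
    (S : ℝ → X →L[ℝ] X) (A : X →ₗ.[ℝ] X) : Prop :=
  ∀ x y, (x, y) ∈ A.graph ↔
    Tendsto (fun t : ℝ => t⁻¹ • (S t x - x)) (𝓝[>] 0) (𝓝 y)

end

/-! Along characteristics the equation only transports and mixes. A state has the form `R(x) U(t -
x)`, where `R(x)` is the exponential of `x` times the exchange matrix (`propagator`) and `U` is the
inflow signal, extended into the past so as to encode the initial state (`traj`). Mild solutions are
unique by an energy estimate, so all of them have this form and every boundary law becomes a law for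
signals. At almost every time the end value is `R(l) U(t - l)`; undelayed feedback is therefore the
delay equation `U(s) = G U(s - l)` with the matrix `G` = feedback after `R(l)` (`roundTrip`).
Exchange does not increase `h₂ c₀² + h₁ c₁²` and the gain bounds make the feedback shrink it, so
`‖Gⁿ‖` decays geometrically (`exists_roundTrip_pow_le`). This yields the semigroup and its decay
(`exists_feedbackFlow`).

In the closed loop the control and the delay cancel from the observer error, whose signal `W` thus
solves the same delay equation. The predictor for time `t` carries the observer signal `U + W` up to
time `t - τ` and `U` afterwards, and its end value reads this signal at `t - l`. If `l ≤ τ`, the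
error has left the tube and `U(s) = G U(s - l)` for `s > τ`. If `τ < l`, then `U(s) = G U(s - l) +
W(s)`. This forcing is resonant: `(s / l) W(s)` is a particular solution, so `U - (s / l) W` is
unforced (`Returns.sub_smul_iff`). Hence the plant decays like `(1 + t) exp(-γ₀ t)`, which any `γ <
γ₀` absorbs. The norm of the image of `w` under the generator enters through the bounded inverse
(`IsFeedbackFlow.exists_norm_le`). -/

noncomputable section

/-! ### Product rule for primitives of integrable functions -/

/-- A function whose increments are dominated by those of an absolutely continuous function is
absolutely continuous. -/
lemma AbsolutelyContinuousOnInterval.of_dist_le {E : Type*} [NormedAddCommGroup E]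
    {F : ℝ → E} {N : ℝ → ℝ} {a b : ℝ} (hN : AbsolutelyContinuousOnInterval N a b)
    (h : ∀ x ∈ uIcc a b, ∀ y ∈ uIcc a b, dist (F x) (F y) ≤ dist (N x) (N y)) :
    AbsolutelyContinuousOnInterval F a b := by
  rw [absolutelyContinuousOnInterval_iff] at hN ⊢
  intro ε hε
  obtain ⟨δ, hδ, hd⟩ := hN ε hε
  refine ⟨δ, hδ, fun I hI hlen => (Finset.sum_le_sum fun i hi => ?_).trans_lt (hd I hI hlen)⟩
  have := hI.1 i hi
  exact h _ this.1 _ this.2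

/-- Integration of the derivative of a product of two primitives. -/
lemma bilinear_eq_integral {E F G : Type*} [NormedAddCommGroup E] [NormedSpace ℝ E]
    [CompleteSpace E] [NormedAddCommGroup F] [NormedSpace ℝ F] [CompleteSpace F]
    [NormedAddCommGroup G] [NormedSpace ℝ G] [CompleteSpace G]
    (B : E →L[ℝ] F →L[ℝ] G) {l : ℝ} (hl : 0 ≤ l)
    {V v : ℝ → E} {W w : ℝ → F}
    (hv : IntervalIntegrable v volume 0 l) (hw : IntervalIntegrable w volume 0 l)
    (hV : ∀ x ∈ Icc 0 l, V x = V 0 + ∫ s in (0 : ℝ)..x, v s)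
    (hW : ∀ x ∈ Icc 0 l, W x = W 0 + ∫ s in (0 : ℝ)..x, w s) :
    IntervalIntegrable (fun s => B (v s) (W s) + B (V s) (w s)) volume 0 l ∧
    B (V l) (W l) = B (V 0) (W 0) + ∫ s in (0 : ℝ)..l, (B (v s) (W s) + B (V s) (w s)) := by
  have h0 : (0 : ℝ) ∈ Icc 0 l := left_mem_Icc.2 hl
  have hVc : ContinuousOn V (Icc 0 l) := by
    have := intervalIntegral.continuousOn_primitive_interval' hv left_mem_uIcc
    rw [uIcc_of_le hl] at this
    exact (continuousOn_const.add this).congr hV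
  have hWc : ContinuousOn W (Icc 0 l) := by
    have := intervalIntegral.continuousOn_primitive_interval' hw left_mem_uIcc
    rw [uIcc_of_le hl] at this
    exact (continuousOn_const.add this).congr hW
  obtain ⟨K, hK⟩ := isCompact_Icc.exists_bound_of_continuousOn hVc
  obtain ⟨J, hJ⟩ := isCompact_Icc.exists_bound_of_continuousOn hWc
  have hK0 : 0 ≤ K := (norm_nonneg _).trans (hK 0 h0)
  have hJ0 : 0 ≤ J := (norm_nonneg _).trans (hJ 0 h0)
  have hsub : ∀ {x y}, x ∈ Icc 0 l → y ∈ Icc 0 l → uIcc x y ⊆ uIcc 0 l := by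
    intro x y hx hy
    rw [uIcc_of_le hl]
    exact uIcc_subset_Icc hx hy
  set d : ℝ → G := fun s => B (v s) (W s) + B (V s) (w s) with hd
  have hdi : IntervalIntegrable d volume 0 l := by
    rw [intervalIntegrable_iff_integrableOn_Icc_of_le hl] at hv hw ⊢
    refine Integrable.add ?_ ?_
    · refine Integrable.mono' (g := fun s => ‖B‖ * J * ‖v s‖) (hv.norm.const_mul _) ?_ ?_
      · exact B.aestronglyMeasurable_comp₂ hv.aestronglyMeasurable
          (hWc.aestronglyMeasurable measurableSet_Icc)
      · filter_upwards [ae_restrict_mem measurableSet_Icc] with s hs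
        calc ‖B (v s) (W s)‖ ≤ ‖B‖ * ‖v s‖ * ‖W s‖ := B.le_opNorm₂ _ _
          _ ≤ ‖B‖ * ‖v s‖ * J := by gcongr; exact hJ s hs
          _ = _ := by ring
    · refine Integrable.mono' (g := fun s => ‖B‖ * K * ‖w s‖) (hw.norm.const_mul _) ?_ ?_
      · exact B.aestronglyMeasurable_comp₂ (hVc.aestronglyMeasurable measurableSet_Icc)
          hw.aestronglyMeasurable
      · filter_upwards [ae_restrict_mem measurableSet_Icc] with s hs
        calc ‖B (V s) (w s)‖ ≤ ‖B‖ * ‖V s‖ * ‖w s‖ := B.le_opNorm₂ _ _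
          _ ≤ ‖B‖ * K * ‖w s‖ := by gcongr; exact hK s hs
  refine ⟨hdi, ?_⟩
  -- The first two terms control the increments of `B (V x) (W x)`, the third those of the integral
  -- of `d`. Thus `Φ` is absolutely continuous; its derivative vanishes almost everywhere, so it is
  -- constant.
  set m : ℝ → ℝ := fun s => ‖B‖ * J * ‖v s‖ + ‖B‖ * K * ‖w s‖ + ‖d s‖ with hm
  have hmi : IntervalIntegrable m volume 0 l :=
    ((hv.norm.const_mul _).add (hw.norm.const_mul _)).add hdi.norm
  have hN := hmi.absolutelyContinuousOnInterval_intervalIntegral (c := 0) left_mem_uIcc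
  set Φ : ℝ → G := fun x => B (V x) (W x) - ∫ s in (0 : ℝ)..x, d s with hΦ
  have key : ∀ x ∈ Icc 0 l, ∀ y ∈ Icc 0 l, x ≤ y →
      dist (Φ x) (Φ y) ≤ dist (∫ s in (0 : ℝ)..x, m s) (∫ s in (0 : ℝ)..y, m s) := by
    intro x hx y hy hxy
    have hVd : V y - V x = ∫ s in x..y, v s := by
      rw [hV x hx, hV y hy, add_sub_add_left_eq_sub,
        intervalIntegral.integral_interval_sub_left (hv.mono_set (hsub h0 hy))
          (hv.mono_set (hsub h0 hx))]
    have hWd : W y - W x = ∫ s in x..y, w s := by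
      rw [hW x hx, hW y hy, add_sub_add_left_eq_sub,
        intervalIntegral.integral_interval_sub_left (hw.mono_set (hsub h0 hy))
          (hw.mono_set (hsub h0 hx))]
    have hΦd : Φ y - Φ x = B (V y - V x) (W y) + B (V x) (W y - W x) - ∫ s in x..y, d s := by
      rw [← intervalIntegral.integral_interval_sub_left (hdi.mono_set (hsub h0 hy))
          (hdi.mono_set (hsub h0 hx))]
      simp only [hΦ, map_sub, sub_apply]
      abel
    rw [dist_eq_norm', dist_eq_norm', hΦd,
      intervalIntegral.integral_interval_sub_left (hmi.mono_set (hsub h0 hy))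
          (hmi.mono_set (hsub h0 hx))]
    refine le_trans ?_ (le_abs_self _)
    have e1 : ‖B (V y - V x) (W y)‖ ≤ ∫ s in x..y, ‖B‖ * J * ‖v s‖ := by
      rw [intervalIntegral.integral_const_mul]
      calc _ ≤ ‖B‖ * ‖V y - V x‖ * ‖W y‖ := B.le_opNorm₂ _ _
        _ ≤ ‖B‖ * (∫ s in x..y, ‖v s‖) * J := by
          gcongr
          · exact mul_nonneg (norm_nonneg B)
              (intervalIntegral.integral_nonneg hxy fun _ _ => norm_nonneg _)
          · rw [hVd]; exact intervalIntegral.norm_integral_le_integral_norm hxy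
          · exact hJ y hy
        _ = _ := by ring
    have e2 : ‖B (V x) (W y - W x)‖ ≤ ∫ s in x..y, ‖B‖ * K * ‖w s‖ := by
      rw [intervalIntegral.integral_const_mul]
      calc _ ≤ ‖B‖ * ‖V x‖ * ‖W y - W x‖ := B.le_opNorm₂ _ _
        _ ≤ ‖B‖ * K * (∫ s in x..y, ‖w s‖) := by
          gcongr
          · exact hK x hx
          · rw [hWd]; exact intervalIntegral.norm_integral_le_integral_norm hxy
    have e3 : ‖∫ s in x..y, d s‖ ≤ ∫ s in x..y, ‖d s‖ :=
      intervalIntegral.norm_integral_le_integral_norm hxy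
    have e4 : (∫ s in x..y, m s) = (∫ s in x..y, ‖B‖ * J * ‖v s‖) +
        (∫ s in x..y, ‖B‖ * K * ‖w s‖) + ∫ s in x..y, ‖d s‖ := by
      rw [← intervalIntegral.integral_add ((hv.norm.const_mul _).mono_set (hsub hx hy))
          ((hw.norm.const_mul _).mono_set (hsub hx hy)),
        ← intervalIntegral.integral_add 
          (((hv.norm.const_mul _).add (hw.norm.const_mul _)).mono_set (hsub hx hy))
          (hdi.norm.mono_set (hsub hx hy))]
    rw [e4]
    exact (norm_sub_le _ _).trans (add_le_add ((norm_add_le _ _).trans (add_le_add e1 e2)) e3)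
  have hAC : AbsolutelyContinuousOnInterval Φ 0 l := by
    refine hN.of_dist_le fun x hx y hy => ?_
    rw [uIcc_of_le hl] at hx hy
    rcases le_total x y with hxy | hxy
    · exact key x hx y hy hxy
    · rw [dist_comm (Φ x), dist_comm (∫ s in (0 : ℝ)..x, m s)]
      exact key y hy x hx hxy
  obtain ⟨C, hC⟩ := hAC.const_of_ae_hasDerivAt_zero (by
    have hne : ∀ᵐ x : ℝ, x ≠ 0 ∧ x ≠ l := by
      filter_upwards [(measure_singleton (0 : ℝ) : volume {(0 : ℝ)} = 0) |> compl_mem_ae_iff.2,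
        (measure_singleton l : volume {l} = 0) |> compl_mem_ae_iff.2] with x h1 h2
      exact ⟨h1, h2⟩
    filter_upwards [hv.ae_hasDerivAt_integral, hw.ae_hasDerivAt_integral,
      hdi.ae_hasDerivAt_integral, hne] with x h1 h2 h3 hx0 hx
    have hx' : x ∈ Ioo 0 l := by
      rw [uIcc_of_le hl] at hx
      exact ⟨lt_of_le_of_ne hx.1 hx0.1.symm, lt_of_le_of_ne hx.2 hx0.2⟩
    have hnb : ∀ᶠ y in 𝓝 x, y ∈ Icc 0 l :=
      Filter.mem_of_superset (isOpen_Ioo.mem_nhds hx') Ioo_subset_Icc_self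
    have dV : HasDerivAt V (v x) x :=
      ((h1 hx 0 left_mem_uIcc).const_add (V 0)).congr_of_eventuallyEq (hnb.mono hV)
    have dW : HasDerivAt W (w x) x :=
      ((h2 hx 0 left_mem_uIcc).const_add (W 0)).congr_of_eventuallyEq (hnb.mono hW)
    have := (B.hasDerivAt_of_bilinear (u := V) (v := W) (fun _ => dV) (fun _ => dW)).sub
      (h3 hx 0 left_mem_uIcc)
    convert! this using 1
    simp [hd, add_comm])
  have e1 := hC l right_mem_uIcc
  have e2 := hC 0 left_mem_uIcc
  rw [← e2] at e1
  simp only [hΦ, intervalIntegral.integral_same, sub_zero] at e1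
  exact sub_eq_iff_eq_add.1 e1

/-! ### Exchange along characteristics -/

/-- The solution operator of the exchange equation along a characteristic. -/
def propagator (h₁ h₂ x : ℝ) : Plane →L[ℝ] Plane := NormedSpace.exp (x • exchange h₁ h₂)

lemma propagator_zero (h₁ h₂ : ℝ) : propagator h₁ h₂ 0 = 1 := by
  have h : (0 : ℝ) • exchange h₁ h₂ = 0 := by ext1 c; simp
  rw [propagator, h, NormedSpace.exp_zero]

lemma propagator_add (h₁ h₂ x y : ℝ) :
    propagator h₁ h₂ (x + y) = propagator h₁ h₂ x * propagator h₁ h₂ y := by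
  have h : (x + y) • exchange h₁ h₂ = x • exchange h₁ h₂ + y • exchange h₁ h₂ := by
    ext1 c; simp [add_smul]
  rw [propagator, h]
  let : NormedAlgebra ℚ (Plane →L[ℝ] Plane) := NormedAlgebra.restrictScalars ℚ ℝ _
  refine NormedSpace.exp_add_of_commute ?_
  change x • exchange h₁ h₂ * y • exchange h₁ h₂ = y • exchange h₁ h₂ * x • exchange h₁ h₂
  ext1 c
  simp [smul_smul, mul_comm x y]

lemma propagator_apply_apply (h₁ h₂ x y : ℝ) (c : Plane) :
    propagator h₁ h₂ x (propagator h₁ h₂ y c) = propagator h₁ h₂ (x + y) c := by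
  rw [propagator_add]; rfl

lemma propagator_neg_apply (h₁ h₂ x : ℝ) (c : Plane) :
    propagator h₁ h₂ (-x) (propagator h₁ h₂ x c) = c := by
  rw [propagator_apply_apply, neg_add_cancel, propagator_zero]; rfl

lemma propagator_apply_neg (h₁ h₂ x : ℝ) (c : Plane) :
    propagator h₁ h₂ x (propagator h₁ h₂ (-x) c) = c := by
  rw [propagator_apply_apply, add_neg_cancel, propagator_zero]; rfl

lemma hasDerivAt_propagator (h₁ h₂ x : ℝ) :
    HasDerivAt (propagator h₁ h₂) (exchange h₁ h₂ * propagator h₁ h₂ x) x :=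
  hasDerivAt_exp_smul_const' (𝕂 := ℝ) (exchange h₁ h₂) x

lemma hasDerivAt_propagator' (h₁ h₂ x : ℝ) :
    HasDerivAt (propagator h₁ h₂) (propagator h₁ h₂ x * exchange h₁ h₂) x :=
  hasDerivAt_exp_smul_const (𝕂 := ℝ) (exchange h₁ h₂) x

lemma continuous_propagator (h₁ h₂ : ℝ) : Continuous (propagator h₁ h₂) :=
  continuous_iff_continuousAt.2 fun x => (hasDerivAt_propagator h₁ h₂ x).continuousAt

/-- The derivative of `x ↦ propagator x (V x)` for a primitive `V`. -/
lemma propagator_primitive (h₁ h₂ : ℝ) {l : ℝ} {V v : ℝ → Plane}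
    (hv : IntervalIntegrable v volume 0 l)
    (hV : ∀ x ∈ Icc 0 l, V x = V 0 + ∫ s in (0 : ℝ)..x, v s) {x : ℝ} (hx : x ∈ Icc 0 l) :
    propagator h₁ h₂ x (V x) = V 0 + ∫ s in (0 : ℝ)..x,
      (exchange h₁ h₂ (propagator h₁ h₂ s (V s)) + propagator h₁ h₂ s (v s)) := by
  have hR : Continuous fun s => exchange h₁ h₂ * propagator h₁ h₂ s :=
    continuous_const.mul (continuous_propagator h₁ h₂)
  -- The identity, read as a bilinear map, is the evaluation pairing of an operator with a vector.
  have := (bilinear_eq_integral (ContinuousLinearMap.id ℝ (Plane →L[ℝ] Plane)) hx.1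
    (V := propagator h₁ h₂) (hR.intervalIntegrable 0 x)
    (hv.mono_set (by rw [uIcc_of_le hx.1, uIcc_of_le (hx.1.trans hx.2)]
                     exact Icc_subset_Icc_right hx.2))
    (fun y _ => by
      rw [intervalIntegral.integral_eq_sub_of_hasDerivAt
        (fun z _ => hasDerivAt_propagator h₁ h₂ z) (hR.intervalIntegrable 0 y)]
      abel)
    (fun y hy => hV y ⟨hy.1, hy.2.trans hx.2⟩)).2
  simpa [propagator_zero] using this

/-- The derivative of `x ↦ propagator (-x) (V x)` for a primitive `V`. -/
lemma propagator_neg_primitive (h₁ h₂ : ℝ) {l : ℝ} {V v : ℝ → Plane}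
    (hv : IntervalIntegrable v volume 0 l)
    (hV : ∀ x ∈ Icc 0 l, V x = V 0 + ∫ s in (0 : ℝ)..x, v s) {x : ℝ} (hx : x ∈ Icc 0 l) :
    propagator h₁ h₂ (-x) (V x) = V 0 - ∫ s in (0 : ℝ)..x,
      propagator h₁ h₂ (-s) (-v s + exchange h₁ h₂ (V s)) := by
  have hR : Continuous fun s => -(propagator h₁ h₂ (-s) * exchange h₁ h₂) :=
    (((continuous_propagator h₁ h₂).comp continuous_neg).mul continuous_const).neg
  have := (bilinear_eq_integral (ContinuousLinearMap.id ℝ (Plane →L[ℝ] Plane)) hx.1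
    (V := fun s => propagator h₁ h₂ (-s)) (hR.intervalIntegrable 0 x)
    (hv.mono_set (by rw [uIcc_of_le hx.1, uIcc_of_le (hx.1.trans hx.2)]
                     exact Icc_subset_Icc_right hx.2))
    (fun y _ => by
      rw [intervalIntegral.integral_eq_sub_of_hasDerivAt
        (f := fun s => propagator h₁ h₂ (-s)) (fun z _ => by
          have := (hasDerivAt_propagator' h₁ h₂ (-z)).scomp z (hasDerivAt_neg z)
          simpa [Function.comp_def] using this) (hR.intervalIntegrable 0 y)]
      abel)
    (fun y hy => hV y ⟨hy.1, hy.2.trans hx.2⟩)).2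
  simp only [ContinuousLinearMap.id_apply, neg_zero, propagator_zero] at this
  rw [this, sub_eq_add_neg, ← intervalIntegral.integral_neg]
  congr 1
  refine intervalIntegral.integral_congr fun s _ => ?_
  simp only [neg_apply, mul_apply_eq_comp, map_add, map_neg]
  abel

/-- The energy of a primitive that vanishes at `0` is nonnegative. -/
lemma integral_inner_primitive_nonneg {l : ℝ} (hl : 0 ≤ l) {V v : ℝ → Plane}
    (hv : IntervalIntegrable v volume 0 l)
    (hV : ∀ x ∈ Icc 0 l, V x = V 0 + ∫ s in (0 : ℝ)..x, v s) (h0 : V 0 = 0) :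
    0 ≤ ∫ s in (0 : ℝ)..l, inner ℝ (V s) (v s) := by
  have := (bilinear_eq_integral (innerSL ℝ (E := Plane)) hl hv hv hV hV).2
  have e : (∫ s in (0 : ℝ)..l, (innerSL ℝ (v s) (V s) + innerSL ℝ (V s) (v s))) =
      2 * ∫ s in (0 : ℝ)..l, inner ℝ (V s) (v s) := by
    rw [← intervalIntegral.integral_const_mul]
    refine intervalIntegral.integral_congr fun s _ => ?_
    change inner ℝ (v s) (V s) + inner ℝ (V s) (v s) = _
    rw [real_inner_comm, two_mul]
  rw [e, h0] at this
  change inner ℝ (V l) (V l) = inner ℝ (0 : Plane) 0 + _ at this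
  rw [inner_zero_left, zero_add] at this
  have h2 : 0 ≤ inner ℝ (V l) (V l) := real_inner_self_nonneg
  linarith

/-! ### Locally square integrable signals -/

/-- Locally square integrable signals. -/
def LocL2 (U : ℝ → Plane) : Prop := ∀ a b : ℝ, MemLp U 2 (volume.restrict (Ioc a b))

namespace LocL2

variable {U W : ℝ → Plane}

lemma of_memLp (h : MemLp U 2 volume) : LocL2 U := fun _ _ => h.restrict _

lemma add (hU : LocL2 U) (hW : LocL2 W) : LocL2 (fun s => U s + W s) :=
  fun a b => (hU a b).add (hW a b)

lemma sub (hU : LocL2 U) (hW : LocL2 W) : LocL2 (fun s => U s - W s) :=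
  fun a b => (hU a b).sub (hW a b)

lemma const_smul (hU : LocL2 U) (c : ℝ) : LocL2 (fun s => c • U s) :=
  fun a b => (hU a b).const_smul c

lemma clm (hU : LocL2 U) (G : Plane →L[ℝ] Plane) : LocL2 (fun s => G (U s)) :=
  fun a b => G.comp_memLp' (hU a b)

lemma smul_fun (hU : LocL2 U) {φ : ℝ → ℝ} (hφ : Continuous φ) : LocL2 (fun s => φ s • U s) := by
  intro a b
  obtain ⟨K, hK⟩ := (isCompact_Icc (a := a) (b := b)).exists_bound_of_continuousOn hφ.continuousOn
  refine MemLp.of_le_mul (c := K) (hU a b)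
    (hφ.aestronglyMeasurable.smul (hU a b).aestronglyMeasurable) ?_
  filter_upwards [ae_restrict_mem measurableSet_Ioc] with s hs
  rw [norm_smul]
  gcongr
  exact hK s (Ioc_subset_Icc_self hs)

lemma clm_fun (hU : LocL2 U) {R : ℝ → Plane →L[ℝ] Plane} (hR : Continuous R) :
    LocL2 (fun s => R s (U s)) := by
  intro a b
  obtain ⟨K, hK⟩ := (isCompact_Icc (a := a) (b := b)).exists_bound_of_continuousOn hR.continuousOn
  refine MemLp.of_le_mul (c := K) (hU a b)
    ((ContinuousLinearMap.id ℝ (Plane →L[ℝ] Plane)).aestronglyMeasurable_comp₂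
      hR.aestronglyMeasurable (hU a b).aestronglyMeasurable) ?_
  filter_upwards [ae_restrict_mem measurableSet_Ioc] with s hs
  exact (R s).le_of_opNorm_le (hK s (Ioc_subset_Icc_self hs)) _

lemma shift (hU : LocL2 U) (c : ℝ) : LocL2 (fun s => U (s + c)) := by
  intro a b
  have h := (measurePreserving_add_right volume c).restrict_preimage
    (measurableSet_Ioc (a := a + c) (b := b + c))
  rw [preimage_add_const_Ioc, add_sub_cancel_right, add_sub_cancel_right] at h
  exact (hU (a + c) (b + c)).comp_measurePreserving h

lemma comp_const_sub (hU : LocL2 U) (t l : ℝ) :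
    MemLp (fun x => U (t - x)) 2 (volume.restrict (Ioo 0 l)) := by
  have h := (Measure.measurePreserving_sub_left volume t).restrict_preimage
    (measurableSet_Ioc (a := t - l) (b := t))
  rw [preimage_const_sub_Ioc, sub_self, sub_sub_cancel] at h
  exact ((hU (t - l) t).comp_measurePreserving h).mono_measure
    (Measure.restrict_mono_set _ Ioo_subset_Ico_self)

lemma ite (hU : LocL2 U) (hW : LocL2 W) (a : ℝ) :
    LocL2 (fun s => if s ≤ a then U s else W s) := by
  intro c d
  have := MemLp.piecewise (s := Iic a) measurableSet_Iic ((hU c d).restrict (Iic a))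
    ((hW c d).restrict (Iic a)ᶜ)
  convert! this using 1

lemma integrableOn (hU : LocL2 U) (a b : ℝ) : IntegrableOn U (Ioc a b) :=
  (hU a b).integrable (by norm_num)

lemma intervalIntegrable (hU : LocL2 U) (a b : ℝ) : IntervalIntegrable U volume a b :=
  ⟨hU.integrableOn a b, hU.integrableOn b a⟩

lemma locallyIntegrable (hU : LocL2 U) : LocallyIntegrable U volume := by
  intro x
  exact ⟨Ioc (x - 1) (x + 1), Ioc_mem_nhds (by linarith) (by linarith), hU.integrableOn _ _⟩

lemma memLp_indicator (hU : LocL2 U) (a b : ℝ) : MemLp ((Ioc a b).indicator U) 2 volume :=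
  (memLp_indicator_iff_restrict measurableSet_Ioc).2 (hU a b)

end LocL2

/-! ### States as travelling waves -/

lemma exists_propagator_bound (l h₁ h₂ : ℝ) :
    ∃ K : ℝ, 0 < K ∧ ∀ x, |x| ≤ l → ‖propagator h₁ h₂ x‖ ≤ K := by
  obtain ⟨K, hK⟩ := (isCompact_Icc (a := -l) (b := l)).exists_bound_of_continuousOn
    (continuous_propagator h₁ h₂).continuousOn
  exact ⟨max K 1, by positivity, fun x hx => (hK x (abs_le.1 hx)).trans (le_max_left _ _)⟩

lemma LocL2.memLp_wave {U : ℝ → Plane} (hU : LocL2 U) (l h₁ h₂ t : ℝ) :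
    MemLp (fun x => propagator h₁ h₂ x (U (t - x))) 2 (volume.restrict (Ioo 0 l)) := by
  obtain ⟨K, -, hK⟩ := exists_propagator_bound l h₁ h₂
  have h := hU.comp_const_sub t l
  refine MemLp.of_le_mul (c := K) h
    ((ContinuousLinearMap.id ℝ (Plane →L[ℝ] Plane)).aestronglyMeasurable_comp₂
      (continuous_propagator h₁ h₂).aestronglyMeasurable h.aestronglyMeasurable) ?_
  filter_upwards [ae_restrict_mem measurableSet_Ioo] with x hx
  exact ContinuousLinearMap.le_of_opNorm_le _
    (hK x (by rw [abs_of_pos hx.1]; exact hx.2.le)) _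

open Classical in
/-- The state at time `t` of the heat exchanger whose inflow at time `s` is `U s`; values of `U`
at past times encode the initial state. -/
def traj (l h₁ h₂ : ℝ) (U : ℝ → Plane) (t : ℝ) : State l :=
  if h : MemLp (fun x => propagator h₁ h₂ x (U (t - x))) 2 (volume.restrict (Ioo 0 l))
  then h.toLp else 0

lemma LocL2.coeFn_traj {U : ℝ → Plane} (hU : LocL2 U) (l h₁ h₂ t : ℝ) :
    traj l h₁ h₂ U t =ᵐ[volume.restrict (Ioo 0 l)] fun x => propagator h₁ h₂ x (U (t - x)) := by
  rw [traj, dif_pos (hU.memLp_wave l h₁ h₂ t)]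
  exact MemLp.coeFn_toLp _

/-- Almost every time property, seen along the tube. -/
lemma ae_comp_const_sub {P : ℝ → Prop} {a b : ℝ} (h : ∀ᵐ s : ℝ, s ∈ Ioo a b → P s) (t : ℝ) :
    ∀ᵐ x : ℝ, t - x ∈ Ioo a b → P (t - x) :=
  (Measure.measurePreserving_sub_left volume t).quasiMeasurePreserving.ae h

/-- The tube remembers exactly one passage time of the signal. -/
lemma traj_congr {l h₁ h₂ : ℝ} {U W : ℝ → Plane} (hU : LocL2 U) (hW : LocL2 W) {t : ℝ}
    (h : ∀ᵐ s : ℝ, s ∈ Ioo (t - l) t → U s = W s) : traj l h₁ h₂ U t = traj l h₁ h₂ W t := by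
  refine Lp.ext ((hU.coeFn_traj l h₁ h₂ t).trans (EventuallyEq.trans ?_
    (hW.coeFn_traj l h₁ h₂ t).symm))
  filter_upwards [ae_restrict_mem measurableSet_Ioo, ae_restrict_of_ae (ae_comp_const_sub h t)]
    with x hx h1
  rw [h1 ⟨by linarith [hx.2], by linarith [hx.1]⟩]

lemma traj_add {l h₁ h₂ : ℝ} {U W : ℝ → Plane} (hU : LocL2 U) (hW : LocL2 W) (t : ℝ) :
    traj l h₁ h₂ (fun s => U s + W s) t = traj l h₁ h₂ U t + traj l h₁ h₂ W t := by
  refine Lp.ext (((hU.add hW).coeFn_traj l h₁ h₂ t).trans ?_)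
  filter_upwards [Lp.coeFn_add (traj l h₁ h₂ U t) (traj l h₁ h₂ W t), hU.coeFn_traj l h₁ h₂ t,
    hW.coeFn_traj l h₁ h₂ t] with x e1 e2 e3
  rw [e1, Pi.add_apply, e2, e3, map_add]

lemma traj_sub {l h₁ h₂ : ℝ} {U W : ℝ → Plane} (hU : LocL2 U) (hW : LocL2 W) (t : ℝ) :
    traj l h₁ h₂ (fun s => U s - W s) t = traj l h₁ h₂ U t - traj l h₁ h₂ W t := by
  refine Lp.ext (((hU.sub hW).coeFn_traj l h₁ h₂ t).trans ?_)
  filter_upwards [Lp.coeFn_sub (traj l h₁ h₂ U t) (traj l h₁ h₂ W t), hU.coeFn_traj l h₁ h₂ t,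
    hW.coeFn_traj l h₁ h₂ t] with x e1 e2 e3
  rw [e1, Pi.sub_apply, e2, e3, map_sub]

lemma traj_smul {l h₁ h₂ : ℝ} {U : ℝ → Plane} (hU : LocL2 U) (c t : ℝ) :
    traj l h₁ h₂ (fun s => c • U s) t = c • traj l h₁ h₂ U t := by
  refine Lp.ext (((hU.const_smul c).coeFn_traj l h₁ h₂ t).trans ?_)
  filter_upwards [Lp.coeFn_smul c (traj l h₁ h₂ U t), hU.coeFn_traj l h₁ h₂ t] with x e1 e2
  rw [e1, Pi.smul_apply, e2, map_smul]

lemma traj_shift {l h₁ h₂ : ℝ} {U : ℝ → Plane} (hU : LocL2 U) (c t : ℝ) :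
    traj l h₁ h₂ (fun s => U (s + c)) t = traj l h₁ h₂ U (t + c) := by
  refine Lp.ext (((hU.shift c).coeFn_traj l h₁ h₂ t).trans
    (EventuallyEq.trans ?_ (hU.coeFn_traj l h₁ h₂ (t + c)).symm))
  filter_upwards with x
  rw [sub_add_eq_add_sub]

/-- The signal on `(a - l, a)` that encodes the state `z` at time `a`. -/
def history (l h₁ h₂ a : ℝ) (z : State l) : ℝ → Plane :=
  (Ioo (a - l) a).indicator fun s => propagator h₁ h₂ (s - a) (z (a - s))

lemma locL2_history (l h₁ h₂ a : ℝ) (z : State l) : LocL2 (history l h₁ h₂ a z) := by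
  refine LocL2.of_memLp ((memLp_indicator_iff_restrict measurableSet_Ioo).2 ?_)
  have h := (Measure.measurePreserving_sub_left volume a).restrict_preimage
    (measurableSet_Ioo (a := 0) (b := l))
  rw [preimage_const_sub_Ioo, sub_zero] at h
  have h1 : MemLp (fun s => z (a - s)) 2 (volume.restrict (Ioo (a - l) a)) :=
    (Lp.memLp z).comp_measurePreserving h
  obtain ⟨K, -, hK⟩ := exists_propagator_bound l h₁ h₂
  refine MemLp.of_le_mul (c := K) h1
    ((ContinuousLinearMap.id ℝ (Plane →L[ℝ] Plane)).aestronglyMeasurable_comp₂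
      ((continuous_propagator h₁ h₂).comp
        (continuous_id.sub continuous_const)).aestronglyMeasurable h1.aestronglyMeasurable) ?_
  filter_upwards [ae_restrict_mem measurableSet_Ioo] with s hs
  exact ContinuousLinearMap.le_of_opNorm_le _
    (hK _ (abs_le.2 ⟨by linarith [hs.1], by linarith [hs.2, hs.1]⟩)) _

lemma traj_eq_of_history {l h₁ h₂ a : ℝ} {z : State l} {U : ℝ → Plane} (hU : LocL2 U)
    (h : ∀ s ∈ Ioo (a - l) a, U s = history l h₁ h₂ a z s) : traj l h₁ h₂ U a = z := by
  refine Lp.ext ((hU.coeFn_traj l h₁ h₂ a).trans ?_)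
  filter_upwards [ae_restrict_mem measurableSet_Ioo] with x hx
  have hm : a - x ∈ Ioo (a - l) a := ⟨by linarith [hx.2], by linarith [hx.1]⟩
  rw [h _ hm, history, indicator_of_mem hm, sub_sub_cancel, sub_sub_cancel_left,
    propagator_apply_neg]

/-- Translation is continuous in `L²` of the line, and the propagator is bounded on the tube. -/
lemma continuous_traj_of_memLp (l h₁ h₂ : ℝ) {U : ℝ → Plane} (hU : MemLp U 2 volume) :
    Continuous (traj l h₁ h₂ U) := by
  obtain ⟨K, hK0, hK⟩ := exists_propagator_bound l h₁ h₂
  let r : ℝ → C(ℝ, ℝ) := fun t => ⟨fun x => t - x, by fun_prop⟩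
  have hr : Continuous r := ContinuousMap.continuous_of_continuous_uncurry _
    (by change Continuous fun p : ℝ × ℝ => p.1 - p.2; fun_prop)
  have hrm : ∀ t, MeasurePreserving (r t) volume volume :=
    fun t => Measure.measurePreserving_sub_left volume t
  have hc : Continuous fun t => Lp.compMeasurePreserving (r t) (hrm t) hU.toLp :=
    Continuous.compMeasurePreservingLp continuous_const hr hrm (by norm_num)
  have hL := LocL2.of_memLp hU
  have hb : ∀ t s, dist (traj l h₁ h₂ U t) (traj l h₁ h₂ U s) ≤
      K * dist (Lp.compMeasurePreserving (r t) (hrm t) hU.toLp)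
        (Lp.compMeasurePreserving (r s) (hrm s) hU.toLp) := by
    intro t s
    set p := Lp.compMeasurePreserving (r t) (hrm t) hU.toLp
    set q := Lp.compMeasurePreserving (r s) (hrm s) hU.toLp
    have hp : ∀ t, Lp.compMeasurePreserving (r t) (hrm t) hU.toLp =ᵐ[volume]
        fun x => U (t - x) := fun t =>
      (Lp.coeFn_compMeasurePreserving _ (hrm t)).trans
        ((hrm t).quasiMeasurePreserving.ae_eq_comp hU.coeFn_toLp)
    rw [dist_eq_norm, dist_eq_norm, Lp.norm_def, Lp.norm_def]
    have h1 : eLpNorm (traj l h₁ h₂ U t - traj l h₁ h₂ U s : State l) 2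
        (volume.restrict (Ioo 0 l)) ≤
        ENNReal.ofReal K * eLpNorm (p - q : Lp Plane 2 volume) 2 (volume.restrict (Ioo 0 l)) := by
      refine eLpNorm_le_mul_eLpNorm_of_ae_le_mul ?_ 2
      filter_upwards [Lp.coeFn_sub (traj l h₁ h₂ U t) (traj l h₁ h₂ U s),
        hL.coeFn_traj l h₁ h₂ t, hL.coeFn_traj l h₁ h₂ s, ae_restrict_of_ae (Lp.coeFn_sub p q),
        ae_restrict_of_ae (hp t), ae_restrict_of_ae (hp s), ae_restrict_mem measurableSet_Ioo]
        with x e1 e2 e3 e4 e5 e6 hx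
      rw [e1, Pi.sub_apply, e2, e3, e4, Pi.sub_apply, e5, e6, ← map_sub]
      exact ContinuousLinearMap.le_of_opNorm_le _
        (hK x (by rw [abs_of_pos hx.1]; exact hx.2.le)) _
    have h2 := h1.trans (mul_le_mul_right (eLpNorm_mono_measure _ Measure.restrict_le_self) _)
    have h3 := ENNReal.toReal_mono
      (ENNReal.mul_ne_top ENNReal.ofReal_ne_top (Lp.eLpNorm_ne_top _)) h2
    rwa [ENNReal.toReal_mul, ENNReal.toReal_ofReal hK0.le] at h3
  rw [Metric.continuous_iff] at hc ⊢
  intro s ε hε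
  obtain ⟨δ, hδ, hd⟩ := hc s (ε / K) (by positivity)
  refine ⟨δ, hδ, fun t ht => (hb t s).trans_lt ?_⟩
  have := hd t ht
  rwa [lt_div_iff₀' hK0] at this

/-- Continuity is local in time, and near `t` only a bounded window of the signal matters, so the
signal may be cut off. -/
lemma LocL2.continuous_traj {U : ℝ → Plane} (hU : LocL2 U) (l h₁ h₂ : ℝ) :
    Continuous (traj l h₁ h₂ U) := by
  refine continuous_iff_continuousAt.2 fun t => ?_
  have hm := hU.memLp_indicator (t - 1 - l) (t + 1)
  refine (continuous_traj_of_memLp l h₁ h₂ hm).continuousAt.congr ?_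
  filter_upwards [Ioo_mem_nhds (show t - 1 < t by linarith) (show t < t + 1 by linarith)]
    with s hs
  refine traj_congr (LocL2.of_memLp hm) hU (Eventually.of_forall fun r hr => ?_)
  have hr' : r ∈ Ioc (t - 1 - l) (t + 1) := ⟨by linarith [hr.1, hs.1], by linarith [hr.2, hs.2]⟩
  exact indicator_of_mem hr' _

/-! ### Travelling waves are mild solutions -/

lemma integral_wave_eq {U : ℝ → Plane} (hU : LocL2 U) (a b : ℝ) (x : ℝ) :
    (∫ s in a..b, U (s - x)) = (∫ s in a..b, U (s - 0)) +
      ∫ y in (0 : ℝ)..x, (U (a - y) - U (b - y)) := by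
  have h1 : ∀ c d, IntervalIntegrable U volume c d := hU.intervalIntegrable
  have h2 : ∀ c, IntervalIntegrable (fun y => U (c - y)) volume 0 x := fun c => by
    have := (h1 (c - 0) (c - x)).comp_sub_left c
    simpa using this
  rw [intervalIntegral.integral_sub (h2 a) (h2 b), intervalIntegral.integral_comp_sub_right,
    intervalIntegral.integral_comp_sub_right, intervalIntegral.integral_comp_sub_left,
    intervalIntegral.integral_comp_sub_left, sub_zero, sub_zero]
  have e1 := intervalIntegral.integral_add_adjacent_intervals (h1 (a - x) a) (h1 a b)
  have e2 := intervalIntegral.integral_add_adjacent_intervals (h1 (a - x) (b - x)) (h1 (b - x) b)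
  rw [← add_sub_assoc, add_comm, e1, ← e2, add_sub_cancel_right]

/-- After cut-offs this is the integrand of the convolution of the propagator with the signal. It
licenses exchanging the time and space integrals. -/
lemma integrable_wave {U : ℝ → Plane} (hU : LocL2 U) (l h₁ h₂ a b : ℝ) :
    Integrable (fun p : ℝ × ℝ => propagator h₁ h₂ p.2 (U (p.1 - p.2)))
      ((volume.restrict (Ioc a b)).prod (volume.restrict (Ioo 0 l))) := by
  have hg : Integrable ((Ioc (a - l) b).indicator U) volume :=
    (integrable_indicator_iff measurableSet_Ioc).2 (hU.integrableOn _ _)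
  have hf : Integrable ((Ioo 0 l).indicator (propagator h₁ h₂)) volume :=
    (integrable_indicator_iff measurableSet_Ioo).2
      (((continuous_propagator h₁ h₂).integrableOn_Icc).mono_set Ioo_subset_Icc_self)
  have h := hf.convolution_integrand (ContinuousLinearMap.id ℝ (Plane →L[ℝ] Plane)) hg
  rw [Measure.prod_restrict]
  refine (h.mono_measure Measure.restrict_le_self).congr ?_
  filter_upwards [ae_restrict_mem (measurableSet_Ioc.prod measurableSet_Ioo)] with p hp
  have h1 : p.1 - p.2 ∈ Ioc (a - l) b :=
    ⟨by linarith [hp.1.1, hp.2.2], by linarith [hp.1.2, hp.2.1]⟩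
  rw [indicator_of_mem hp.2, indicator_of_mem h1]
  rfl

/-- Integration in time of a trajectory can be done pointwise. -/
lemma LocL2.coeFn_integral_traj {U : ℝ → Plane} (hU : LocL2 U) (l h₁ h₂ : ℝ) {a b : ℝ}
    (hab : a ≤ b) :
    (∫ s in a..b, traj l h₁ h₂ U s : State l) =ᵐ[volume.restrict (Ioo 0 l)]
      fun x => propagator h₁ h₂ x (∫ s in a..b, U (s - x)) := by
  have hF := integrable_wave hU l h₁ h₂ a b
  have hti : IntervalIntegrable (traj l h₁ h₂ U) volume a b :=
    (hU.continuous_traj l h₁ h₂).intervalIntegrable a b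
  have hpt : ∀ x, (∫ s in a..b, propagator h₁ h₂ x (U (s - x))) =
      propagator h₁ h₂ x (∫ s in a..b, U (s - x)) := fun x => by
    refine (propagator h₁ h₂ x).intervalIntegral_comp_comm ?_
    have := (hU.intervalIntegrable (a - x) (b - x)).comp_sub_right x
    simpa using this
  have hRi : Integrable (fun x => propagator h₁ h₂ x (∫ s in a..b, U (s - x)))
      (volume.restrict (Ioo 0 l)) := by
    simp_rw [← hpt, intervalIntegral.integral_of_le hab]
    exact hF.integral_prod_right
  -- The left side is an integral of `L²`-valued functions. It is identified by pairing with vector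
  -- multiples of indicators, where Fubini applies.
  refine Integrable.ae_eq_of_forall_setIntegral_eq _ _
    ((Lp.memLp _).integrable (by norm_num)) hRi fun A hA hAm => ?_
  refine ext_inner_left ℝ fun c => ?_
  have hFA : Integrable (fun p : ℝ × ℝ => inner ℝ c (propagator h₁ h₂ p.2 (U (p.1 - p.2))))
      ((volume.restrict (Ioc a b)).prod ((volume.restrict (Ioo 0 l)).restrict A)) := by
    have : Integrable (fun p : ℝ × ℝ => propagator h₁ h₂ p.2 (U (p.1 - p.2)))
        ((volume.restrict (Ioc a b)).prod ((volume.restrict (Ioo 0 l)).restrict A)) :=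
      hF.mono_measure (Measure.prod_mono le_rfl Measure.restrict_le_self)
    exact this.const_inner c
  calc inner ℝ c (∫ x in A, (∫ s in a..b, traj l h₁ h₂ U s : State l) x ∂volume.restrict (Ioo 0 l))
      = inner ℝ (indicatorConstLp 2 hA hAm.ne c) (∫ s in a..b, traj l h₁ h₂ U s) :=
        (L2.inner_indicatorConstLp_eq_inner_setIntegral ℝ hA hAm.ne c _).symm
    _ = ∫ s in a..b, inner ℝ (indicatorConstLp 2 hA hAm.ne c) (traj l h₁ h₂ U s) :=
        ((innerSL ℝ (indicatorConstLp 2 hA hAm.ne c)).intervalIntegral_comp_comm hti).symm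
    _ = ∫ s in a..b, (∫ x in A, inner ℝ c (propagator h₁ h₂ x (U (s - x)))
          ∂volume.restrict (Ioo 0 l)) := by
        refine intervalIntegral.integral_congr fun s _ => ?_
        beta_reduce
        rw [L2.inner_indicatorConstLp_eq_setIntegral_inner]
        refine integral_congr_ae (ae_restrict_of_ae ?_)
        filter_upwards [hU.coeFn_traj l h₁ h₂ s] with x hx
        rw [hx]
    _ = ∫ x in A, (∫ s in a..b, inner ℝ c (propagator h₁ h₂ x (U (s - x))))
          ∂volume.restrict (Ioo 0 l) := by
        simp_rw [intervalIntegral.integral_of_le hab]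
        exact integral_integral_swap hFA
    _ = ∫ x in A, inner ℝ c (propagator h₁ h₂ x (∫ s in a..b, U (s - x)))
          ∂volume.restrict (Ioo 0 l) := by
        refine integral_congr_ae (Eventually.of_forall fun x => ?_)
        beta_reduce
        rw [← hpt]
        refine (innerSL ℝ c).intervalIntegral_comp_comm ?_
        have := ((hU.intervalIntegrable (a - x) (b - x)).comp_sub_right x)
        have h2 : IntervalIntegrable (fun s => U (s - x)) volume a b := by simpa using this
        exact ⟨(propagator h₁ h₂ x).integrable_comp h2.1, (propagator h₁ h₂ x).integrable_comp h2.2⟩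
    _ = _ := integral_inner hRi.integrableOn c

/-- Trajectories are mild in time: the heat operator maps the integral to the increment. -/
lemma LocL2.heatOp_integral_traj {U : ℝ → Plane} (hU : LocL2 U) {l : ℝ} (h₁ h₂ : ℝ)
    {a b : ℝ} (hab : a ≤ b) :
    HeatOp l h₁ h₂ (∫ s in a..b, traj l h₁ h₂ U s) (traj l h₁ h₂ U b - traj l h₁ h₂ U a)
      (∫ s in a..b, U s) (propagator h₁ h₂ l (∫ s in a..b, U (s - l))) := by
  set Z : State l := ∫ s in a..b, traj l h₁ h₂ U s with hZ
  set V : ℝ → Plane := fun x => ∫ s in a..b, U (s - x) with hVdef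
  have hZc := hU.coeFn_integral_traj l h₁ h₂ hab
  refine ⟨fun x => propagator h₁ h₂ x (V x),
    (exchange h₁ h₂).compLp Z - (traj l h₁ h₂ U b - traj l h₁ h₂ U a), ⟨hZc, ?_⟩, by abel, ?_, rfl⟩
  · intro x hx
    have h2 : ∀ c, IntervalIntegrable (fun y => U (c - y)) volume 0 x := fun c => by
      have := (hU.intervalIntegrable (c - 0) (c - x)).comp_sub_left c
      simpa using this
    -- Time averaging makes `V` a primitive in `x`, with derivative `U (a - x) - U (b - x)`. The
    -- propagator turns this difference into the difference of the two states and adds the exchange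
    -- term.
    have := propagator_primitive h₁ h₂ (V := V) ((h2 a).sub (h2 b))
      (fun y _ => integral_wave_eq hU a b y) (right_mem_Icc.2 hx.1)
    rw [this, propagator_zero]
    change V 0 + _ = V 0 + _
    congr 1
    refine (State.integral_congr ?_ hx).symm
    filter_upwards [Lp.coeFn_sub ((exchange h₁ h₂).compLp Z)
      (traj l h₁ h₂ U b - traj l h₁ h₂ U a), Lp.coeFn_sub (traj l h₁ h₂ U b) (traj l h₁ h₂ U a),
      (exchange h₁ h₂).coeFn_compLp Z, hU.coeFn_traj l h₁ h₂ a, hU.coeFn_traj l h₁ h₂ b, hZc]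
      with y e1 e2 e3 e4 e5 e6
    rw [e1, Pi.sub_apply, e2, Pi.sub_apply, e3, e4, e5, e6, map_sub]
    abel
  · simp [hVdef, propagator_zero]

/-- Existence of mild solutions. -/
lemma LocL2.isMildSolution {U u : ℝ → Plane} (hU : LocL2 U) {l h₁ h₂ a b : ℝ} {z : ℝ → State l}
    {z₀ : State l} (hz : ∀ t ∈ Icc a b, z t = traj l h₁ h₂ U t) (hab : a ≤ b)
    (hz₀ : traj l h₁ h₂ U a = z₀) (hu : ∀ᵐ s : ℝ, s ∈ Ioc a b → u s = U s) :
    IsMildSolution l h₁ h₂ a b z₀ u z where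
  continuousOn := (hU.continuous_traj l h₁ h₂).continuousOn.congr hz
  initial := by rw [hz a (left_mem_Icc.2 hab), hz₀]
  input := (memLp_congr_ae ((ae_restrict_iff' measurableSet_Ioc).2 hu)).2 (hU a b)
  equation t ht := by
    refine ⟨propagator h₁ h₂ l (∫ s in a..t, U (s - l)), ?_⟩
    have h := hU.heatOp_integral_traj (l := l) h₁ h₂ ht.1
    have e1 : (∫ s in a..t, z s) = ∫ s in a..t, traj l h₁ h₂ U s :=
      intervalIntegral.integral_congr fun s hs => by
        rw [uIcc_of_le ht.1] at hs
        exact hz s ⟨hs.1, hs.2.trans ht.2⟩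
    have e2 : (∫ s in a..t, u s) = ∫ s in a..t, U s := by
      refine intervalIntegral.integral_congr_ae (hu.mono fun s hs hm => ?_)
      rw [uIoc_of_le ht.1] at hm
      exact hs ⟨hm.1, hm.2.trans ht.2⟩
    rwa [e1, e2, hz t ht, ← hz₀]

/-! ### Uniqueness of mild solutions -/

/-- The heat operator with zero inflow is bounded above. -/
lemma HeatOp.inner_le {l h₁ h₂ : ℝ} (hl : 0 ≤ l) {z w : State l} {b : Plane}
    (h : HeatOp l h₁ h₂ z w 0 b) : inner ℝ z w ≤ ‖exchange h₁ h₂‖ * ‖z‖ ^ 2 := by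
  obtain ⟨f, g, hf, rfl, h0, -⟩ := h
  -- With zero inflow, this inner product is half the squared norm of the outflow value `f l`.
  have e1 : 0 ≤ inner ℝ z g := by
    have h1 := integral_inner_primitive_nonneg hl (g.intervalIntegrable (right_mem_Icc.2 hl))
      hf.eq_integral h0
    rw [intervalIntegral.integral_of_le hl, integral_Ioc_eq_integral_Ioo] at h1
    rw [L2.inner_def]
    refine h1.trans_eq (integral_congr_ae ?_)
    filter_upwards [hf.rep] with x hx
    rw [hx]
  have e2 : inner ℝ z ((exchange h₁ h₂).compLp z) ≤ ‖exchange h₁ h₂‖ * ‖z‖ ^ 2 :=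
    calc inner ℝ z ((exchange h₁ h₂).compLp z) ≤ ‖z‖ * ‖(exchange h₁ h₂).compLp z‖ :=
          real_inner_le_norm _ _
      _ ≤ ‖z‖ * (‖exchange h₁ h₂‖ * ‖z‖) := by
          gcongr; exact ContinuousLinearMap.norm_compLp_le _ _
      _ = _ := by ring
  rw [inner_add_right, inner_neg_right]
  linarith

lemma HeatOp.sub {l h₁ h₂ : ℝ} {z w z' w' : State l} {a b a' b' : Plane}
    (h : HeatOp l h₁ h₂ z w a b) (h' : HeatOp l h₁ h₂ z' w' a' b') :
    HeatOp l h₁ h₂ (z - z') (w - w') (a - a') (b - b') := by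
  have := h.add (h'.smul (-1))
  simpa only [neg_smul, one_smul, ← sub_eq_add_neg] using this

/-- Uniqueness of mild solutions. -/
lemma IsMildSolution.unique {l h₁ h₂ a b : ℝ} (hl : 0 ≤ l) {z₀ : State l} {u u' : ℝ → Plane}
    {z z' : ℝ → State l} (h : IsMildSolution l h₁ h₂ a b z₀ u z)
    (h' : IsMildSolution l h₁ h₂ a b z₀ u' z') (hu : ∀ᵐ s : ℝ, s ∈ Ioc a b → u s = u' s)
    {t : ℝ} (ht : t ∈ Icc a b) : z t = z' t := by
  have hab : a ≤ b := ht.1.trans ht.2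
  set d : ℝ → State l := fun s => z s - z' s with hd
  have hdc : ContinuousOn d (Icc a b) := h.continuousOn.sub h'.continuousOn
  have hsub : ∀ {s}, s ∈ Icc a b → uIcc a s ⊆ Icc a b := fun hs => by
    rw [uIcc_of_le hs.1]; exact Icc_subset_Icc_right hs.2
  set D : ℝ → State l := fun s => ∫ r in a..s, d r with hD
  have heq : ∀ s ∈ Icc a b, ∃ c, HeatOp l h₁ h₂ (D s) (d s) 0 c := by
    intro s hs
    obtain ⟨c, hc⟩ := h.equation s hs
    obtain ⟨c', hc'⟩ := h'.equation s hs
    refine ⟨c - c', ?_⟩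
    have := hc.sub hc'
    rw [← intervalIntegral.integral_sub
      ((h.continuousOn.mono (hsub hs)).intervalIntegrable)
      ((h'.continuousOn.mono (hsub hs)).intervalIntegrable), sub_sub_sub_cancel_right] at this
    have e : (∫ r in a..s, u r) = ∫ r in a..s, u' r :=
      intervalIntegral.integral_congr_ae (hu.mono fun r hr hm => by
        rw [uIoc_of_le hs.1] at hm
        exact hr ⟨hm.1, hm.2.trans hs.2⟩)
    rwa [e, sub_self] at this
  have hDd : ∀ s ∈ Ioo a b, HasDerivAt D (d s) s := by
    intro s hs
    refine intervalIntegral.integral_hasDerivAt_right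
      ((hdc.mono (hsub (Ioo_subset_Icc_self hs))).intervalIntegrable) ?_
      (hdc.continuousAt (Icc_mem_nhds hs.1 hs.2))
    exact (hdc.mono Ioo_subset_Icc_self).stronglyMeasurableAtFilter isOpen_Ioo s hs
  have hDc : ContinuousOn D (Icc a b) := by
    have hdi : IntervalIntegrable d volume a b :=
      (hdc.mono (by rw [uIcc_of_le hab])).intervalIntegrable
    have := intervalIntegral.continuousOn_primitive_interval' hdi (left_mem_uIcc (a := a) (b := b))
    rwa [uIcc_of_le hab] at this
  set κ := ‖exchange h₁ h₂‖
  -- Gronwall: the derivative of `‖D‖²` is `2 ⟨D, d⟩`, which is at most `2 κ ‖D‖²`.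
  set φ : ℝ → ℝ := fun s => Real.exp (-(2 * κ) * s) * ‖D s‖ ^ 2 with hφ
  have hanti : AntitoneOn φ (Icc a b) := by
    have hder : ∀ s ∈ Ioo a b, HasDerivAt φ (Real.exp (-(2 * κ) * s) * (-(2 * κ)) * ‖D s‖ ^ 2 +
        Real.exp (-(2 * κ) * s) * (2 * inner ℝ (D s) (d s))) s := by
      intro s hs
      have h1 : HasDerivAt (fun s => Real.exp (-(2 * κ) * s))
          (Real.exp (-(2 * κ) * s) * (-(2 * κ))) s := by
        simpa using ((hasDerivAt_id s).const_mul (-(2 * κ))).exp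
      exact h1.mul (hDd s hs).norm_sq
    refine antitoneOn_of_deriv_nonpos (convex_Icc a b) ?_ ?_ ?_
    · exact (Continuous.continuousOn (by fun_prop)).mul (hDc.norm.pow 2)
    · rw [interior_Icc]
      exact fun s hs => (hder s hs).differentiableAt.differentiableWithinAt
    · rw [interior_Icc]
      intro s hs
      rw [(hder s hs).deriv]
      obtain ⟨c, hc⟩ := heq s (Ioo_subset_Icc_self hs)
      have h3 := hc.inner_le hl
      have h4 := Real.exp_pos (-(2 * κ) * s)
      nlinarith
  have hDz : ∀ s ∈ Icc a b, D s = 0 := by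
    intro s hs
    have h1 := hanti (left_mem_Icc.2 hab) hs hs.1
    have h2 : φ a = 0 := by simp [hφ, hD]
    rw [h2] at h1
    have h3 := Real.exp_pos (-(2 * κ) * s)
    have h4 : ‖D s‖ ^ 2 ≤ 0 := by
      by_contra hcon
      push Not at hcon
      exact absurd h1 (not_le.2 (mul_pos h3 hcon))
    have h5 : ‖D s‖ = 0 := by nlinarith [norm_nonneg (D s)]
    exact norm_eq_zero.1 h5
  -- The heat operator maps `D t = 0` to `d t`, hence `d t = 0`.
  obtain ⟨c, f, g, hf, hw, -, -⟩ := heq t ht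
  rw [hDz t ht] at hf hw
  have hg := hf.eq_zero
  have h0 : (exchange h₁ h₂).compLp (0 : State l) = 0 := by
    have := exchange_smul h₁ h₂ 0 (0 : State l)
    rwa [zero_smul, zero_smul] at this
  rw [hg, h0, neg_zero, add_zero] at hw
  exact sub_eq_zero.1 hw

/-- Mild solutions are trajectories. -/
lemma IsMildSolution.eq_traj {l h₁ h₂ a b : ℝ} (hl : 0 ≤ l) {z₀ : State l} {u U : ℝ → Plane}
    {z : ℝ → State l} (h : IsMildSolution l h₁ h₂ a b z₀ u z) (hU : LocL2 U)
    (h0 : traj l h₁ h₂ U a = z₀) (hu : ∀ᵐ s : ℝ, s ∈ Ioc a b → u s = U s)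
    {t : ℝ} (ht : t ∈ Icc a b) : z t = traj l h₁ h₂ U t :=
  h.unique hl (hU.isMildSolution (fun _ _ => rfl) (ht.1.trans ht.2) h0
    (Eventually.of_forall fun _ _ => rfl)) hu ht

/-! ### Values at the end of the tubes -/

lemma HasEndValue.unique {l : ℝ} {z : State l} {c c' : Plane} (h : HasEndValue l z c)
    (h' : HasEndValue l z c') : c = c' := tendsto_nhds_unique h h'

/-- At almost every time, states that agree near `x = l` with a travelling wave have an end
value. -/
lemma LocL2.ae_hasEndValue {U : ℝ → Plane} (hU : LocL2 U) (l h₁ h₂ : ℝ) :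
    ∀ᵐ t : ℝ, ∀ z : State l, (∃ δ < l, ∀ᵐ x : ℝ, x ∈ Ioo δ l →
      z x = propagator h₁ h₂ x (U (t - x))) →
      HasEndValue l z (propagator h₁ h₂ l (U (t - l))) := by
  -- For fixed `t` the wave is `propagator t` applied to `W (t - x)`, so the matrix comes out of the
  -- average. Left averages at `x = l` become right averages of `W` at `t - l`, and Lebesgue
  -- differentiation applies.
  set W : ℝ → Plane := fun s => propagator h₁ h₂ (-s) (U s) with hW
  have hWL : LocL2 W := hU.clm_fun ((continuous_propagator h₁ h₂).comp continuous_neg)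
  have h := (measurePreserving_sub_right volume l).quasiMeasurePreserving.ae
    (_root_.LocallyIntegrable.ae_hasDerivAt_integral hWL.locallyIntegrable)
  filter_upwards [h] with t ht z hz
  obtain ⟨δ, hδ, hz⟩ := hz
  have h1 := (ht (t - l)).tendsto_slope_zero_right
  have h2 := ((propagator h₁ h₂ t).continuous.tendsto _).comp h1
  have e0 : propagator h₁ h₂ t (W (t - l)) = propagator h₁ h₂ l (U (t - l)) := by
    rw [hW]
    beta_reduce
    rw [propagator_apply_apply]; congr 2; ring
  rw [e0] at h2
  refine h2.congr' ?_
  filter_upwards [Ioo_mem_nhdsGT (show (0 : ℝ) < l - δ by linarith)] with r hr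
  simp only [Function.comp_apply, intervalIntegral.integral_same, sub_zero, map_smul]
  congr 1
  have e1 : (∫ x in (l - r)..l, z x) = ∫ x in (l - r)..l, propagator h₁ h₂ t (W (t - x)) := by
    have hne : ∀ᵐ x : ℝ, x ≠ l := compl_mem_ae_iff.2 (measure_singleton l)
    refine intervalIntegral.integral_congr_ae ?_
    filter_upwards [hz, hne] with x hx hxl hxm
    rw [uIoc_of_le (by linarith [hr.1])] at hxm
    rw [hx ⟨by linarith [hxm.1, hr.2], lt_of_le_of_ne hxm.2 hxl⟩, hW]
    beta_reduce
    rw [propagator_apply_apply]; congr 2; ring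
  rw [e1]
  have e2 : (∫ x in (l - r)..l, propagator h₁ h₂ t (W (t - x))) =
      propagator h₁ h₂ t (∫ x in (l - r)..l, W (t - x)) := by
    refine (propagator h₁ h₂ t).intervalIntegral_comp_comm ?_
    have := (hWL.intervalIntegrable (t - (l - r)) (t - l)).comp_sub_left t
    simpa using this
  rw [e2, intervalIntegral.integral_comp_sub_left]
  congr 2
  ring

lemma LocL2.ae_hasEndValue_traj {U : ℝ → Plane} (hU : LocL2 U) {l : ℝ} (hl : 0 < l) (h₁ h₂ : ℝ) :
    ∀ᵐ t : ℝ, HasEndValue l (traj l h₁ h₂ U t) (propagator h₁ h₂ l (U (t - l))) := by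
  filter_upwards [hU.ae_hasEndValue l h₁ h₂] with t ht
  exact ht _ ⟨0, hl, (ae_restrict_iff' measurableSet_Ioo).1 (hU.coeFn_traj l h₁ h₂ t)⟩

/-! ### Contraction in one round trip -/

/-- The boundary feedback as a linear map. -/
def feedbackCLM (k₁ k₂ : ℝ) : Plane →L[ℝ] Plane :=
  LinearMap.toContinuousLinearMap
    { toFun := feedback k₁ k₂
      map_add' := feedback_add k₁ k₂
      map_smul' := feedback_smul k₁ k₂ }

/-- The effect of one passage through the tubes, followed by the feedback. -/
def roundTrip (l h₁ h₂ k₁ k₂ : ℝ) : Plane →L[ℝ] Plane :=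
  feedbackCLM k₁ k₂ * propagator h₁ h₂ l

lemma roundTrip_apply (l h₁ h₂ k₁ k₂ : ℝ) (c : Plane) :
    roundTrip l h₁ h₂ k₁ k₂ c = feedback k₁ k₂ (propagator h₁ h₂ l c) := rfl

/-- The weighted energy, which the exchange of heat does not increase. -/
def energy (h₁ h₂ : ℝ) (c : Plane) : ℝ := h₂ * c 0 ^ 2 + h₁ * c 1 ^ 2

/-- The weights balance the two exchange rates: along the flow the energy has derivative `-2 h₁ h₂
(c₀ - c₁)²`. -/
lemma energy_propagator_le {h₁ h₂ : ℝ} (hh₁ : 0 < h₁) (hh₂ : 0 < h₂) {x : ℝ} (hx : 0 ≤ x)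
    (c : Plane) : energy h₁ h₂ (propagator h₁ h₂ x c) ≤ energy h₁ h₂ c := by
  have hd : ∀ y, HasDerivAt (fun y => propagator h₁ h₂ y c)
      (exchange h₁ h₂ (propagator h₁ h₂ y c)) y := fun y =>
    ((ContinuousLinearMap.apply ℝ Plane c).hasFDerivAt.comp_hasDerivAt y
      (hasDerivAt_propagator h₁ h₂ y))
  have hdi : ∀ y (i : Fin 2), HasDerivAt (fun y => propagator h₁ h₂ y c i)
      (exchange h₁ h₂ (propagator h₁ h₂ y c) i) y := fun y i =>
    ((EuclideanSpace.proj i : Plane →L[ℝ] ℝ).hasFDerivAt.comp_hasDerivAt y (hd y))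
  have hE : ∀ y, HasDerivAt (fun y => energy h₁ h₂ (propagator h₁ h₂ y c))
      (-(2 * h₁ * h₂) * (propagator h₁ h₂ y c 0 - propagator h₁ h₂ y c 1) ^ 2) y := by
    intro y
    have := (((hdi y 0).pow 2).const_mul h₂).add (((hdi y 1).pow 2).const_mul h₁)
    refine this.congr_deriv ?_
    rw [exchange_apply]
    simp
    ring
  have hanti : Antitone fun y => energy h₁ h₂ (propagator h₁ h₂ y c) := by
    refine antitone_of_deriv_nonpos (fun y => (hE y).differentiableAt) fun y => ?_
    rw [(hE y).deriv, neg_mul, neg_nonpos]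
    positivity
  have := hanti hx
  simpa [propagator_zero] using this

lemma energy_le {h₁ h₂ : ℝ} (c : Plane) : energy h₁ h₂ c ≤ max h₁ h₂ * ‖c‖ ^ 2 := by
  rw [EuclideanSpace.norm_sq_eq, Fin.sum_univ_two, Real.norm_eq_abs, Real.norm_eq_abs, sq_abs,
    sq_abs, energy]
  nlinarith [le_max_left h₁ h₂, le_max_right h₁ h₂, sq_nonneg (c 0), sq_nonneg (c 1)]

lemma le_energy {h₁ h₂ : ℝ} (c : Plane) : min h₁ h₂ * ‖c‖ ^ 2 ≤ energy h₁ h₂ c := by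
  rw [EuclideanSpace.norm_sq_eq, Fin.sum_univ_two, Real.norm_eq_abs, Real.norm_eq_abs, sq_abs,
    sq_abs, energy]
  nlinarith [min_le_left h₁ h₂, min_le_right h₁ h₂, sq_nonneg (c 0), sq_nonneg (c 1)]

/-- The gain bounds read `k₁² h₂ < h₁` and `k₂² h₁ < h₂`, which say that the feedback multiplies the
weighted energy by at most some `p < 1`. Then `q = √p`, and `C` is the cost of comparing the energy
with the Euclidean norm. -/
lemma exists_roundTrip_pow_le {l h₁ h₂ k₁ k₂ : ℝ} (hl : 0 < l) (hh₁ : 0 < h₁) (hh₂ : 0 < h₂)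
    (hk₁ : 0 < k₁) (hk₁' : k₁ < Real.sqrt (h₁ / h₂)) (hk₂ : 0 < k₂)
    (hk₂' : k₂ < Real.sqrt (h₂ / h₁)) :
    ∃ C q : ℝ, 0 < C ∧ 0 < q ∧ q < 1 ∧ ∀ n : ℕ, ‖roundTrip l h₁ h₂ k₁ k₂ ^ n‖ ≤ C * q ^ n := by
  rw [Real.lt_sqrt hk₁.le, lt_div_iff₀ hh₂] at hk₁'
  rw [Real.lt_sqrt hk₂.le, lt_div_iff₀ hh₁] at hk₂'
  set p := max (k₁ ^ 2 * h₂ / h₁) (k₂ ^ 2 * h₁ / h₂) with hp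
  have hp0 : 0 < p := lt_max_of_lt_left (by positivity)
  have hp1 : p < 1 := max_lt ((div_lt_one hh₁).2 hk₁') ((div_lt_one hh₂).2 hk₂')
  have hpa : k₁ ^ 2 * h₂ ≤ p * h₁ := (div_le_iff₀ hh₁).1 (le_max_left _ _)
  have hpb : k₂ ^ 2 * h₁ ≤ p * h₂ := (div_le_iff₀ hh₂).1 (le_max_right _ _)
  have hfb : ∀ c, energy h₁ h₂ (feedback k₁ k₂ c) ≤ p * energy h₁ h₂ c := by
    intro c
    have e : energy h₁ h₂ (feedback k₁ k₂ c) =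
        (k₁ ^ 2 * h₂) * c 1 ^ 2 + (k₂ ^ 2 * h₁) * c 0 ^ 2 := by
      simp [energy, feedback]; ring
    rw [e, energy]
    nlinarith [mul_le_mul_of_nonneg_right hpa (sq_nonneg (c 1)),
      mul_le_mul_of_nonneg_right hpb (sq_nonneg (c 0))]
  have hpow : ∀ (n : ℕ) c, energy h₁ h₂ ((roundTrip l h₁ h₂ k₁ k₂ ^ n) c) ≤
      p ^ n * energy h₁ h₂ c := by
    intro n
    induction n with
    | zero => intro c; simp
    | succ n ih =>
      intro c
      rw [pow_succ]
      refine (ih (roundTrip l h₁ h₂ k₁ k₂ c)).trans ?_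
      rw [pow_succ, mul_assoc]
      gcongr
      exact (hfb _).trans (mul_le_mul_of_nonneg_left (energy_propagator_le hh₁ hh₂ hl.le c) hp0.le)
  have hm : 0 < min h₁ h₂ := lt_min hh₁ hh₂
  have hM : 0 < max h₁ h₂ := lt_max_of_lt_left hh₁
  refine ⟨Real.sqrt (max h₁ h₂ / min h₁ h₂), Real.sqrt p, Real.sqrt_pos.2 (by positivity),
    Real.sqrt_pos.2 hp0, (Real.sqrt_lt' one_pos).2 (by simpa using hp1), fun n => ?_⟩
  refine ContinuousLinearMap.opNorm_le_bound _ (by positivity) fun c => ?_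
  have h1 := (le_energy _).trans ((hpow n c).trans (mul_le_mul_of_nonneg_left (energy_le c)
    (pow_nonneg hp0.le n)))
  refine abs_le_of_sq_le_sq' ?_ (by positivity) |>.2
  rw [mul_pow, mul_pow, Real.sq_sqrt (by positivity), ← pow_mul, mul_comm n 2, pow_mul,
    Real.sq_sqrt hp0.le, div_mul_eq_mul_div, div_mul_eq_mul_div, le_div_iff₀ hm]
  linarith

/-! ### The delay equation -/

/-- `U` satisfies the delay equation `U(s) = G U(s - l)` at almost all times after `a`. -/
def Returns (G : Plane →L[ℝ] Plane) (l a : ℝ) (U : ℝ → Plane) : Prop :=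
  ∀ᵐ s : ℝ, a < s → U s = G (U (s - l))

namespace Returns

variable {G : Plane →L[ℝ] Plane} {l a : ℝ} {U W : ℝ → Plane}

lemma add (hU : Returns G l a U) (hW : Returns G l a W) : Returns G l a (fun s => U s + W s) := by
  filter_upwards [hU, hW] with s h1 h2 hs
  rw [h1 hs, h2 hs, map_add]

lemma sub (hU : Returns G l a U) (hW : Returns G l a W) : Returns G l a (fun s => U s - W s) := by
  filter_upwards [hU, hW] with s h1 h2 hs
  rw [h1 hs, h2 hs, map_sub]

lemma smul (hU : Returns G l a U) (c : ℝ) : Returns G l a (fun s => c • U s) := by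
  filter_upwards [hU] with s h1 hs
  rw [h1 hs, map_smul]

lemma shift (hU : Returns G l a U) (c : ℝ) : Returns G l (a - c) (fun s => U (s + c)) := by
  have := (measurePreserving_add_right volume c).quasiMeasurePreserving.ae hU
  filter_upwards [this] with s h hs
  rw [h (by linarith), sub_add_eq_add_sub]

lemma mono (hU : Returns G l a U) {b : ℝ} (hab : a ≤ b) : Returns G l b U := by
  filter_upwards [hU] with s h hs
  exact h (hab.trans_lt hs)

/-- The inequality says that the last of the `n` backward steps still starts after `a`. A single
null set serves all `n`. -/
lemma pow (hl : 0 ≤ l) (hU : Returns G l a U) :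
    ∀ᵐ s : ℝ, ∀ n : ℕ, a + n * l < s + l → U s = (G ^ n) (U (s - n * l)) := by
  have h : ∀ᵐ s : ℝ, ∀ n : ℕ, a < s - n * l → U (s - n * l) = G (U (s - n * l - l)) :=
    ae_all_iff.2 fun n =>
      (measurePreserving_sub_right volume ((n : ℝ) * l)).quasiMeasurePreserving.ae hU
  filter_upwards [h] with s hs n
  induction n with
  | zero => intro _; simp
  | succ n ih =>
    intro hn
    push_cast at hn
    rw [ih (by linarith), pow_succ, hs n (by linarith)]
    push_cast
    rw [show s - n * l - l = s - (n + 1) * l by ring]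
    rfl

end Returns

/-- The solution of the delay equation with given values `φ` up to time `a`. -/
def renew (G : Plane →L[ℝ] Plane) (l a : ℝ) (φ : ℝ → Plane) (s : ℝ) : Plane :=
  (G ^ ⌈(s - a) / l⌉₊) (φ (s - ⌈(s - a) / l⌉₊ * l))

lemma renew_of_le (G : Plane →L[ℝ] Plane) {l a : ℝ} (hl : 0 < l) (φ : ℝ → Plane) {s : ℝ}
    (hs : s ≤ a) : renew G l a φ s = φ s := by
  have : ⌈(s - a) / l⌉₊ = 0 :=
    Nat.ceil_eq_zero.2 (div_nonpos_of_nonpos_of_nonneg (by linarith) hl.le)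
  simp [renew, this]

/-- The ceiling counts the passages needed to get back to time at most `a`; after `a`, stepping back
by `l` lowers it by exactly one. -/
lemma renew_of_lt (G : Plane →L[ℝ] Plane) {l a : ℝ} (hl : 0 < l) (φ : ℝ → Plane) {s : ℝ}
    (hs : a < s) : renew G l a φ s = G (renew G l a φ (s - l)) := by
  have h0 : (s - l - a) / l = (s - a) / l - 1 := by field_simp; ring
  have h : ⌈(s - a) / l⌉₊ = ⌈(s - l - a) / l⌉₊ + 1 := by
    have hp : 0 < (s - a) / l := div_pos (by linarith) hl
    rw [h0]
    have : 0 < ⌈(s - a) / l⌉₊ := Nat.ceil_pos.2 hp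
    rw [Nat.ceil_sub_one]
    omega
  rw [renew, renew, h, pow_succ']
  push_cast
  rw [show s - (⌈(s - l - a) / l⌉₊ + 1) * l = s - l - ⌈(s - l - a) / l⌉₊ * l by ring]
  rfl

lemma returns_renew (G : Plane →L[ℝ] Plane) {l : ℝ} (a : ℝ) (hl : 0 < l) (φ : ℝ → Plane) :
    Returns G l a (renew G l a φ) := Eventually.of_forall fun _ hs => renew_of_lt G hl φ hs

/-- Integrability spreads one passage at a time: each truncation arises from the previous one by a
shift and `G`. Every bounded interval lies below some truncation time. -/
lemma LocL2.renew (G : Plane →L[ℝ] Plane) {l : ℝ} (a : ℝ) (hl : 0 < l) {φ : ℝ → Plane}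
    (hφ : LocL2 φ) : LocL2 (renew G l a φ) := by
  have h0 : LocL2 (0 : ℝ → Plane) := fun _ _ => MemLp.zero
  have h : ∀ n : ℕ, LocL2 fun s => if s ≤ a + n * l then _root_.renew G l a φ s else 0 := by
    intro n
    induction n with
    | zero =>
      convert hφ.ite h0 a using 2 with s
      by_cases hs : s ≤ a
      · simp [hs, renew_of_le G hl φ hs]
      · simp [hs]
    | succ n ih =>
      convert hφ.ite ((ih.shift (-l)).clm G) a using 2 with s
      have hnl : 0 ≤ n * l := by positivity
      have e : s + -l ≤ a + n * l ↔ s ≤ a + (n + 1) * l := by constructor <;> intro <;> linarith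
      push_cast
      by_cases hs : s ≤ a
      · rw [if_pos hs, if_pos (by linarith), renew_of_le G hl φ hs]
      · rw [if_neg hs]
        by_cases hs' : s ≤ a + (n + 1) * l
        · rw [if_pos hs', if_pos (e.2 hs'), renew_of_lt G hl φ (not_le.1 hs), sub_eq_add_neg]
        · rw [if_neg hs', if_neg (mt e.1 hs'), map_zero]
  intro c d
  obtain ⟨n, hn⟩ := exists_nat_gt ((d - a) / l)
  rw [div_lt_iff₀ hl] at hn
  refine (memLp_congr_ae ?_).1 (h n c d)
  filter_upwards [ae_restrict_mem measurableSet_Ioc] with s hs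
  rw [if_pos (by linarith [hs.2])]

/-! ### Exponential decay of unforced signals -/

/-- The size of the signal in the tubes. -/
def histNorm (l : ℝ) (U : ℝ → Plane) (t : ℝ) : ENNReal :=
  eLpNorm U 2 (volume.restrict (Ioc (t - l) t))

lemma LocL2.eLpNorm_comp_const_sub {U : ℝ → Plane} (hU : LocL2 U) (l t : ℝ) :
    eLpNorm (fun x => U (t - x)) 2 (volume.restrict (Ioo 0 l)) = histNorm l U t := by
  have h := (Measure.measurePreserving_sub_left volume t).restrict_preimage
    (measurableSet_Ioc (a := t - l) (b := t))
  rw [preimage_const_sub_Ioc, sub_self, sub_sub_cancel,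
    Measure.restrict_congr_set Ioo_ae_eq_Ico.symm] at h
  exact eLpNorm_comp_measurePreserving (hU (t - l) t).aestronglyMeasurable h

/-- The propagator and its inverse are bounded on the tube, so the norms of a state and of its
signal window are equivalent, uniformly in signal and time. -/
lemma exists_traj_bound (l h₁ h₂ : ℝ) : ∃ K : ℝ, 0 < K ∧ ∀ U : ℝ → Plane, LocL2 U → ∀ t,
    eLpNorm (traj l h₁ h₂ U t) 2 (volume.restrict (Ioo 0 l)) ≤ ENNReal.ofReal K * histNorm l U t ∧
    histNorm l U t ≤
      ENNReal.ofReal K * eLpNorm (traj l h₁ h₂ U t) 2 (volume.restrict (Ioo 0 l)) := by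
  obtain ⟨K, hK0, hK⟩ := exists_propagator_bound l h₁ h₂
  refine ⟨K, hK0, fun U hU t => ?_⟩
  rw [← hU.eLpNorm_comp_const_sub]
  constructor
  · refine eLpNorm_le_mul_eLpNorm_of_ae_le_mul ?_ 2
    filter_upwards [hU.coeFn_traj l h₁ h₂ t, ae_restrict_mem measurableSet_Ioo] with x hx hm
    rw [hx]
    exact ContinuousLinearMap.le_of_opNorm_le _
      (hK x (by rw [abs_of_pos hm.1]; exact hm.2.le)) _
  · refine eLpNorm_le_mul_eLpNorm_of_ae_le_mul ?_ 2
    filter_upwards [hU.coeFn_traj l h₁ h₂ t, ae_restrict_mem measurableSet_Ioo] with x hx hm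
    rw [hx]
    conv_lhs => rw [← propagator_neg_apply h₁ h₂ x (U (t - x))]
    exact ContinuousLinearMap.le_of_opNorm_le _
      (hK (-x) (by rw [abs_neg, abs_of_pos hm.1]; exact hm.2.le)) _

lemma Returns.histNorm_add_le {G : Plane →L[ℝ] Plane} {l a : ℝ} {U : ℝ → Plane} (hl : 0 ≤ l)
    (hU : LocL2 U) (h : Returns G l a U) {t : ℝ} (ht : a ≤ t) (n : ℕ) :
    histNorm l U (t + n * l) ≤ ENNReal.ofReal ‖G ^ n‖ * histNorm l U t := by
  have h1 := (measurePreserving_sub_right volume ((n : ℝ) * l)).restrict_preimage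
    (measurableSet_Ioc (a := t - l) (b := t))
  rw [preimage_sub_const_Ioc] at h1
  have h2 : histNorm l U t = eLpNorm (fun s => U (s - n * l)) 2
      (volume.restrict (Ioc (t + n * l - l) (t + n * l))) := by
    rw [← sub_add_eq_add_sub]
    exact (eLpNorm_comp_measurePreserving (hU _ _).aestronglyMeasurable h1).symm
  rw [h2]
  refine eLpNorm_le_mul_eLpNorm_of_ae_le_mul ?_ 2
  filter_upwards [ae_restrict_mem measurableSet_Ioc, ae_restrict_of_ae (h.pow hl)] with s hs hp
  rw [hp n (by linarith [hs.1])]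
  exact ContinuousLinearMap.le_opNorm _ _

/-- The window ending at `t` is split at `a`; its pieces lie in the windows ending at `a` and at `a
+ l`. -/
lemma LocL2.histNorm_le {l a : ℝ} {U : ℝ → Plane} (hU : LocL2 U) {t : ℝ} (ht : a ≤ t)
    (ht' : t ≤ a + l) : histNorm l U t ≤ histNorm l U a + histNorm l U (a + l) := by
  have e : (Ioc (t - l) t).indicator U =
      (Ioc (t - l) a).indicator U + (Ioc a t).indicator U := by
    have hd : Disjoint (Ioc (t - l) a) (Ioc a t) :=
      Set.disjoint_left.2 fun x h1 h2 => absurd h1.2 (not_le.2 h2.1)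
    rw [← Ioc_union_Ioc_eq_Ioc (by linarith : t - l ≤ a) ht]
    exact indicator_union_of_disjoint hd U
  rw [histNorm, ← eLpNorm_indicator_eq_eLpNorm_restrict measurableSet_Ioc, e]
  refine (eLpNorm_add_le (hU.memLp_indicator _ _).1 (hU.memLp_indicator _ _).1
    (by norm_num)).trans ?_
  rw [eLpNorm_indicator_eq_eLpNorm_restrict measurableSet_Ioc,
    eLpNorm_indicator_eq_eLpNorm_restrict measurableSet_Ioc]
  refine add_le_add (eLpNorm_mono_measure _ (Measure.restrict_mono_set _ ?_))
    (eLpNorm_mono_measure _ (Measure.restrict_mono_set _ ?_))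
  · exact Ioc_subset_Ioc_left (by linarith)
  · rw [add_sub_cancel_right]
    exact Ioc_subset_Ioc_right ht'

/-- Exponential decay of trajectories whose signals satisfy the delay equation. -/
lemma exists_returns_decay {l : ℝ} (h₁ h₂ : ℝ) (hl : 0 < l) {G : Plane →L[ℝ] Plane} {C q : ℝ}
    (hC : 0 < C) (hq : 0 < q) (hG : ∀ n : ℕ, ‖G ^ n‖ ≤ C * q ^ n) :
    ∃ M : ℝ, 0 < M ∧ ∀ U : ℝ → Plane, LocL2 U → ∀ a, Returns G l a U → ∀ t, a ≤ t →
      ‖traj l h₁ h₂ U t‖ ≤ M * q ^ ⌊(t - a) / l⌋₊ * ‖traj l h₁ h₂ U a‖ := by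
  obtain ⟨K, hK0, hK⟩ := exists_traj_bound l h₁ h₂
  refine ⟨K * C * (1 + ‖G‖) * K, by positivity, fun U hU a h t ht => ?_⟩
  set n := ⌊(t - a) / l⌋₊ with hn
  have hn1 : n * l ≤ t - a := by
    have := Nat.floor_le (div_nonneg (sub_nonneg.2 ht) hl.le)
    rwa [le_div_iff₀ hl] at this
  have hn2 : t - a < (n + 1) * l := by
    have := Nat.lt_floor_add_one ((t - a) / l)
    rwa [div_lt_iff₀ hl] at this
  -- The `n` full passages yield `G ^ n`; the remaining time `r` lies in `[a, a + l)` and costs only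
  -- the factor `1 + ‖G‖`.
  set r := t - n * l with hr
  have e1 : histNorm l U t ≤ ENNReal.ofReal (C * q ^ n) * histNorm l U r := by
    have := h.histNorm_add_le hl.le hU (t := r) (by linarith) n
    rw [hr, sub_add_cancel] at this
    exact this.trans (mul_le_mul_left (ENNReal.ofReal_le_ofReal (hG n)) _)
  have e2 : histNorm l U r ≤ ENNReal.ofReal (1 + ‖G‖) * histNorm l U a := by
    refine (hU.histNorm_le (a := a) (by linarith) (by linarith)).trans ?_
    have := h.histNorm_add_le hl.le hU le_rfl 1
    rw [Nat.cast_one, one_mul, pow_one] at this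
    rw [ENNReal.ofReal_add zero_le_one (norm_nonneg _), ENNReal.ofReal_one, add_mul, one_mul]
    gcongr
  have e3 : eLpNorm (traj l h₁ h₂ U t) 2 (volume.restrict (Ioo 0 l)) ≤
      ENNReal.ofReal (K * C * (1 + ‖G‖) * K * q ^ n) *
        eLpNorm (traj l h₁ h₂ U a) 2 (volume.restrict (Ioo 0 l)) := by
    calc _ ≤ ENNReal.ofReal K * (ENNReal.ofReal (C * q ^ n) * (ENNReal.ofReal (1 + ‖G‖) *
          (ENNReal.ofReal K * eLpNorm (traj l h₁ h₂ U a) 2 (volume.restrict (Ioo 0 l))))) := by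
          refine (hK U hU t).1.trans ?_
          gcongr
          refine e1.trans ?_
          gcongr
          refine e2.trans ?_
          gcongr
          exact (hK U hU a).2
      _ = _ := by
          rw [← mul_assoc, ← mul_assoc, ← mul_assoc, ← ENNReal.ofReal_mul hK0.le,
            ← ENNReal.ofReal_mul (by positivity), ← ENNReal.ofReal_mul (by positivity)]
          congr 2
          ring
  have e4 := ENNReal.toReal_mono
    (ENNReal.mul_ne_top ENNReal.ofReal_ne_top (Lp.eLpNorm_ne_top _)) e3
  rwa [ENNReal.toReal_mul, ENNReal.toReal_ofReal (by positivity)] at e4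

/-! ### The semigroup of the undelayed feedback system -/

/-- The signal of the undelayed feedback system with initial state `z`. -/
def feedbackSignal (l h₁ h₂ k₁ k₂ : ℝ) (z : State l) : ℝ → Plane :=
  renew (roundTrip l h₁ h₂ k₁ k₂) l 0 (history l h₁ h₂ 0 z)

lemma locL2_feedbackSignal {l : ℝ} (h₁ h₂ k₁ k₂ : ℝ) (hl : 0 < l) (z : State l) :
    LocL2 (feedbackSignal l h₁ h₂ k₁ k₂ z) := (locL2_history l h₁ h₂ 0 z).renew _ 0 hl

lemma returns_feedbackSignal {l : ℝ} (h₁ h₂ k₁ k₂ : ℝ) (hl : 0 < l) (z : State l) :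
    Returns (roundTrip l h₁ h₂ k₁ k₂) l 0 (feedbackSignal l h₁ h₂ k₁ k₂ z) :=
  returns_renew _ 0 hl _

lemma traj_feedbackSignal_zero {l : ℝ} (h₁ h₂ k₁ k₂ : ℝ) (hl : 0 < l) (z : State l) :
    traj l h₁ h₂ (feedbackSignal l h₁ h₂ k₁ k₂ z) 0 = z :=
  traj_eq_of_history (locL2_feedbackSignal h₁ h₂ k₁ k₂ hl z) fun _ hs =>
    renew_of_le _ hl _ hs.2.le

/-- `S` moves trajectories with undelayed feedback forward in time. -/
def IsFeedbackFlow (l h₁ h₂ k₁ k₂ : ℝ) (S : ℝ → State l →L[ℝ] State l) : Prop :=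
  ∀ U : ℝ → Plane, LocL2 U → ∀ a, Returns (roundTrip l h₁ h₂ k₁ k₂) l a U → ∀ t, a ≤ t →
    traj l h₁ h₂ U t = S (t - a) (traj l h₁ h₂ U a)

/-- The decay estimate, applied to a difference with zero initial state, is also a uniqueness
statement. Linearity and the flow property both follow from it. -/
lemma exists_feedbackFlow {l h₁ h₂ k₁ k₂ : ℝ} (hl : 0 < l) (hh₁ : 0 < h₁) (hh₂ : 0 < h₂)
    (hk₁ : 0 < k₁) (hk₁' : k₁ < Real.sqrt (h₁ / h₂)) (hk₂ : 0 < k₂)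
    (hk₂' : k₂ < Real.sqrt (h₂ / h₁)) :
    ∃ S : ℝ → State l →L[ℝ] State l, IsFeedbackFlow l h₁ h₂ k₁ k₂ S ∧
      ∃ M γ₀ : ℝ, 0 < M ∧ 0 < γ₀ ∧ ∀ t, 0 ≤ t → ‖S t‖ ≤ M * Real.exp (-γ₀ * t) := by
  obtain ⟨C, q, hC, hq, hq1, hG⟩ := exists_roundTrip_pow_le hl hh₁ hh₂ hk₁ hk₁' hk₂ hk₂'
  obtain ⟨M, hM, hdec⟩ := exists_returns_decay h₁ h₂ hl hC hq hG
  have hsL := locL2_feedbackSignal h₁ h₂ k₁ k₂ hl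
  have hsR := returns_feedbackSignal h₁ h₂ k₁ k₂ hl
  have hs0 := traj_feedbackSignal_zero h₁ h₂ k₁ k₂ hl
  have huniq : ∀ U W : ℝ → Plane, LocL2 U → LocL2 W → ∀ a,
      Returns (roundTrip l h₁ h₂ k₁ k₂) l a U → Returns (roundTrip l h₁ h₂ k₁ k₂) l a W →
      traj l h₁ h₂ U a = traj l h₁ h₂ W a → ∀ t, a ≤ t →
      traj l h₁ h₂ U t = traj l h₁ h₂ W t := by
    intro U W hU hW a rU rW h0 t ht
    have := hdec _ (hU.sub hW) a (rU.sub rW) t ht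
    rw [traj_sub hU hW, traj_sub hU hW, h0, sub_self, norm_zero, mul_zero] at this
    exact sub_eq_zero.1 (norm_le_zero_iff.1 this)
  have hbd : ∀ t, 0 ≤ t → ∀ z, ‖traj l h₁ h₂ (feedbackSignal l h₁ h₂ k₁ k₂ z) t‖ ≤
      M * q ^ ⌊t / l⌋₊ * ‖z‖ := by
    intro t ht z
    have := hdec _ (hsL z) 0 (hsR z) t ht
    rwa [hs0, sub_zero] at this
  -- Negative times are replaced by `0`, so that each operator is bounded.
  let T : ℝ → State l →ₗ[ℝ] State l := fun t =>
    { toFun := fun z => traj l h₁ h₂ (feedbackSignal l h₁ h₂ k₁ k₂ z) (max t 0)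
      map_add' := fun z w => by
        rw [← traj_add (hsL z) (hsL w)]
        refine huniq _ _ (hsL _) ((hsL z).add (hsL w)) 0 (hsR _) ((hsR z).add (hsR w)) ?_ _
          (le_max_right _ _)
        rw [traj_add (hsL z) (hsL w), hs0, hs0, hs0]
      map_smul' := fun c z => by
        rw [RingHom.id_apply, ← traj_smul (hsL z)]
        refine huniq _ _ (hsL _) ((hsL z).const_smul c) 0 (hsR _) ((hsR z).smul c) ?_ _
          (le_max_right _ _)
        rw [traj_smul (hsL z), hs0, hs0] }
  let S : ℝ → State l →L[ℝ] State l := fun t =>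
    (T t).mkContinuous (M * q ^ ⌊max t 0 / l⌋₊) fun z => hbd _ (le_max_right _ _) z
  -- Since `⌊t / l⌋ ≥ t / l - 1`, the power `q ^ ⌊t / l⌋` is at most `q⁻¹ exp (t log q / l)`.
  refine ⟨S, ?_, M / q, -Real.log q / l, by positivity,
    div_pos (neg_pos.2 (Real.log_neg hq hq1)) hl, ?_⟩
  · intro U hU a rU t ht
    have h1 : S (t - a) (traj l h₁ h₂ U a) =
        traj l h₁ h₂ (feedbackSignal l h₁ h₂ k₁ k₂ (traj l h₁ h₂ U a)) (t - a) := by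
      change traj l h₁ h₂ _ (max (t - a) 0) = _
      rw [max_eq_left (sub_nonneg.2 ht)]
    have h2 := rU.shift a
    rw [sub_self] at h2
    have h3 := huniq _ _ (hU.shift a) (hsL (traj l h₁ h₂ U a)) 0 h2 (hsR _)
      (by rw [traj_shift hU, zero_add, hs0]) (t - a) (sub_nonneg.2 ht)
    rw [h1, ← h3, traj_shift hU, sub_add_cancel]
  · intro t ht
    have h1 : ‖S t‖ ≤ M * q ^ ⌊t / l⌋₊ := by
      have : ‖S t‖ ≤ M * q ^ ⌊max t 0 / l⌋₊ :=
        (T t).mkContinuous_norm_le (by positivity) fun z => hbd _ (le_max_right _ _) z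
      rwa [max_eq_left ht] at this
    refine h1.trans ?_
    rw [div_mul_eq_mul_div, mul_div_assoc]
    gcongr
    rw [le_div_iff₀ hq, ← pow_succ, ← Real.rpow_natCast, Real.rpow_def_of_pos hq]
    refine Real.exp_le_exp.2 ?_
    have h2 : t / l ≤ (⌊t / l⌋₊ + 1 : ℕ) := by
      push_cast; exact (Nat.lt_floor_add_one _).le
    have h3 := mul_le_mul_of_nonpos_left h2 (Real.log_neg hq hq1).le
    calc Real.log q * ((⌊t / l⌋₊ + 1 : ℕ) : ℝ) ≤ Real.log q * (t / l) := h3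
      _ = _ := by ring

namespace IsFeedbackFlow

variable {l h₁ h₂ k₁ k₂ : ℝ} {S : ℝ → State l →L[ℝ] State l}

lemma apply_eq (hS : IsFeedbackFlow l h₁ h₂ k₁ k₂ S) (hl : 0 < l) (z : State l) {t : ℝ}
    (ht : 0 ≤ t) : S t z = traj l h₁ h₂ (feedbackSignal l h₁ h₂ k₁ k₂ z) t := by
  have := hS _ (locL2_feedbackSignal h₁ h₂ k₁ k₂ hl z) 0
    (returns_feedbackSignal h₁ h₂ k₁ k₂ hl z) t ht
  rw [this, traj_feedbackSignal_zero h₁ h₂ k₁ k₂ hl, sub_zero]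

lemma isC0Semigroup (hS : IsFeedbackFlow l h₁ h₂ k₁ k₂ S) (hl : 0 < l) : IsC0Semigroup S where
  zero := by
    ext1 z
    rw [hS.apply_eq hl z le_rfl, traj_feedbackSignal_zero h₁ h₂ k₁ k₂ hl]
    rfl
  add s t hs ht := by
    ext1 z
    have := hS _ (locL2_feedbackSignal h₁ h₂ k₁ k₂ hl z) t
      ((returns_feedbackSignal h₁ h₂ k₁ k₂ hl z).mono ht) (s + t) (by linarith)
    rw [add_sub_cancel_right, ← hS.apply_eq hl z ht, ← hS.apply_eq hl z (by positivity)] at this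
    exact this
  continuousOn z := ((locL2_feedbackSignal h₁ h₂ k₁ k₂ hl z).continuous_traj l h₁ h₂).continuousOn.congr
    fun _ ht => hS.apply_eq hl z ht

end IsFeedbackFlow

/-! ### The generator and its inverse -/

lemma LocL2.of_continuous {U : ℝ → Plane} (hU : Continuous U) : LocL2 U := by
  intro a b
  obtain ⟨K, hK⟩ := (isCompact_Icc (a := a) (b := b)).exists_bound_of_continuousOn hU.continuousOn
  refine MemLp.of_bound hU.aestronglyMeasurable K ?_
  filter_upwards [ae_restrict_mem measurableSet_Ioc] with s hs
  exact hK s (Ioc_subset_Icc_self hs)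

/-- On the domain of the generator, the signal of a trajectory is a primitive of the signal of the
image. -/
lemma IsFeedbackFlow.sub_eq_integral {l h₁ h₂ k₁ k₂ : ℝ} {S : ℝ → State l →L[ℝ] State l}
    (hS : IsFeedbackFlow l h₁ h₂ k₁ k₂ S) (hl : 0 < l) {z y : State l}
    (hzy : (z, y) ∈ feedbackGraph l h₁ h₂ k₁ k₂) {t : ℝ} (ht : 0 ≤ t) :
    S t z - z = ∫ s in (0 : ℝ)..t, traj l h₁ h₂ (feedbackSignal l h₁ h₂ k₁ k₂ y) s := by
  obtain ⟨c, f, g, hf, hy, hf0, hfl⟩ := hzy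
  simp only at hf hy
  set G := roundTrip l h₁ h₂ k₁ k₂ with hG
  set V := feedbackSignal l h₁ h₂ k₁ k₂ y with hV
  have hVL : LocL2 V := locL2_feedbackSignal h₁ h₂ k₁ k₂ hl y
  have hVi := hVL.intervalIntegrable
  set W : ℝ → Plane := fun s => f 0 + ∫ r in (0 : ℝ)..s, V r with hW
  have hWL : LocL2 W := LocL2.of_continuous
    (continuous_const.add (intervalIntegral.continuous_primitive hVi 0))
  -- The derivative of `propagator (-x) (f x)` is minus `propagator (-x)` applied to `y`, that is,
  -- minus the past signal of `y` at `-x`. Thus the primitive `W` has `z` as its state at time `0`.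
  have hWneg : ∀ x ∈ Icc 0 l, W (-x) = propagator h₁ h₂ (-x) (f x) := by
    intro x hx
    rw [propagator_neg_primitive h₁ h₂ (g.intervalIntegrable (right_mem_Icc.2 hl.le))
      hf.eq_integral hx, hW]
    beta_reduce
    rw [sub_eq_add_neg]
    congr 1
    have e1 := intervalIntegral.integral_comp_neg (a := 0) (b := x) V
    rw [neg_zero] at e1
    rw [intervalIntegral.integral_symm, ← e1]
    congr 1
    refine intervalIntegral.integral_congr_ae ?_
    have hne : ∀ᵐ x : ℝ, x ≠ l := compl_mem_ae_iff.2 (measure_singleton l)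
    have hyae := (ae_restrict_iff' measurableSet_Ioo).1
      ((Lp.coeFn_add (-g) ((exchange h₁ h₂).compLp z)).and
      ((Lp.coeFn_neg g).and (((exchange h₁ h₂).coeFn_compLp z).and hf.rep)))
    filter_upwards [hne, hyae] with r hrl hr hrm
    rw [uIoc_of_le hx.1] at hrm
    have hr' : r ∈ Ioo 0 l := ⟨hrm.1, lt_of_le_of_ne (hrm.2.trans hx.2) hrl⟩
    obtain ⟨a1, a2, a3, a4⟩ := hr hr'
    have hm : -r ∈ Ioo (0 - l) 0 := ⟨by linarith [hr'.2], by linarith [hr'.1]⟩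
    rw [hV, feedbackSignal, renew_of_le _ hl _ hm.2.le, history, indicator_of_mem hm, sub_zero,
      zero_sub, neg_neg, hy, a1, Pi.add_apply, a2, a3, Pi.neg_apply, a4]
  have hWR : Returns G l 0 W := by
    refine Eventually.of_forall fun s hs => ?_
    have e1 : (∫ r in (0 : ℝ)..s, V r) = ∫ r in (0 : ℝ)..s, G (V (r - l)) := by
      refine intervalIntegral.integral_congr_ae ?_
      filter_upwards [returns_feedbackSignal h₁ h₂ k₁ k₂ hl y] with r hr hrm
      rw [uIoc_of_le hs.le] at hrm
      exact hr hrm.1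
    have e2 : (∫ r in (0 : ℝ)..s, G (V (r - l))) = G (∫ r in (0 : ℝ)..s, V (r - l)) := by
      refine G.intervalIntegral_comp_comm ?_
      have := (hVi (0 - l) (s - l)).comp_sub_right l
      simpa using this
    have e3 : W (s - l) = W (-l) + ∫ r in (0 : ℝ)..s, V (r - l) := by
      rw [intervalIntegral.integral_comp_sub_right, zero_sub, hW]
      beta_reduce
      rw [add_assoc, intervalIntegral.integral_add_adjacent_intervals (hVi _ _) (hVi _ _)]
    -- The boundary condition of the domain is what makes the integration constants on both sides of
    -- the delay equation agree.
    have e4 : G (W (-l)) = f 0 := by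
      rw [hWneg l (right_mem_Icc.2 hl.le), hG, roundTrip_apply, propagator_apply_neg, hfl, hf0]
    rw [e3, map_add, e4, ← e2, ← e1]
  have hW0 : traj l h₁ h₂ W 0 = z := by
    refine Lp.ext ((hWL.coeFn_traj l h₁ h₂ 0).trans ?_)
    filter_upwards [ae_restrict_mem measurableSet_Ioo, hf.rep] with x hx hxr
    rw [zero_sub, hWneg x (Ioo_subset_Icc_self hx), propagator_apply_neg, hxr]
  have hSt : S t z = traj l h₁ h₂ W t := by
    have := hS W hWL 0 hWR t ht
    rw [this, hW0, sub_zero]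
  rw [hSt]
  conv_lhs => rw [← hW0]
  refine Lp.ext ((Lp.coeFn_sub _ _).trans (EventuallyEq.trans ?_
    (hVL.coeFn_integral_traj l h₁ h₂ ht).symm))
  filter_upwards [hWL.coeFn_traj l h₁ h₂ t, hWL.coeFn_traj l h₁ h₂ 0] with x e1 e2
  rw [Pi.sub_apply, e1, e2, ← map_sub, intervalIntegral.integral_comp_sub_right, hW]
  beta_reduce
  rw [add_sub_add_left_eq_sub, intervalIntegral.integral_interval_sub_left (hVi _ _) (hVi _ _)]

/-- A fixed vector of `G` is fixed by all powers, which tend to `0`. So `1 - G` is injective, hence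
onto in finite dimension. -/
lemma exists_sub_roundTrip {G : Plane →L[ℝ] Plane} {C q : ℝ} (hq : 0 < q) (hq1 : q < 1)
    (hG : ∀ n : ℕ, ‖G ^ n‖ ≤ C * q ^ n) (b : Plane) : ∃ a, a - G a = b := by
  have hinj : Function.Injective (1 - G : Plane →L[ℝ] Plane).toLinearMap := by
    refine (injective_iff_map_eq_zero _).2 fun c hc => ?_
    have h1 : G c = c := (sub_eq_zero.1 (show c - G c = 0 from hc)).symm
    have h2 : ∀ n : ℕ, (G ^ n) c = c := by
      intro n
      induction n with
      | zero => rfl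
      | succ n ih =>
        rw [pow_succ]
        change (G ^ n) (G c) = c
        rw [h1, ih]
    have h3 : ∀ n : ℕ, ‖c‖ ≤ C * q ^ n * ‖c‖ := fun n => by
      conv_lhs => rw [← h2 n]
      exact ContinuousLinearMap.le_of_opNorm_le _ (hG n) _
    have h4 : Tendsto (fun n : ℕ => C * q ^ n * ‖c‖) atTop (𝓝 (C * 0 * ‖c‖)) :=
      ((tendsto_pow_atTop_nhds_zero_of_lt_one hq.le hq1).const_mul C).mul_const _
    have h5 := ge_of_tendsto' h4 h3
    rw [mul_zero, zero_mul] at h5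
    exact norm_le_zero_iff.1 h5
  obtain ⟨a, ha⟩ := LinearMap.injective_iff_surjective.1 hinj b
  exact ⟨a, ha⟩

/-- The operator of the feedback system is onto. -/
lemma exists_mem_feedbackGraph {l h₁ h₂ k₁ k₂ : ℝ} (hl : 0 < l)
    (hG : ∀ b, ∃ a, a - roundTrip l h₁ h₂ k₁ k₂ a = b) (y : State l) :
    ∃ z, (z, y) ∈ feedbackGraph l h₁ h₂ k₁ k₂ := by
  set v : ℝ → Plane := fun s => -propagator h₁ h₂ (-s) (y s) with hv
  have hvi : IntervalIntegrable v volume 0 l := by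
    rw [intervalIntegrable_iff_integrableOn_Ioo_of_le hl.le]
    obtain ⟨K, -, hK⟩ := exists_propagator_bound l h₁ h₂
    have hyi : IntegrableOn y (Ioo (0 : ℝ) l) volume := (Lp.memLp y).integrable (by norm_num)
    refine Integrable.neg (Integrable.mono' (hyi.norm.const_mul K)
      ((ContinuousLinearMap.id ℝ (Plane →L[ℝ] Plane)).aestronglyMeasurable_comp₂
        ((continuous_propagator h₁ h₂).comp continuous_neg).aestronglyMeasurable
        hyi.aestronglyMeasurable) ?_)
    filter_upwards [ae_restrict_mem measurableSet_Ioo] with x hm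
    exact ContinuousLinearMap.le_of_opNorm_le _
      (hK (-x) (by rw [abs_neg, abs_of_pos hm.1]; exact hm.2.le)) _
  set J : ℝ → Plane := fun x => ∫ s in (0 : ℝ)..x, v s with hJ
  -- Variation of constants gives `f x = propagator x (a + J x)`. The boundary condition then reads
  -- `a = G (a + J l)`.
  obtain ⟨a, ha⟩ := hG (roundTrip l h₁ h₂ k₁ k₂ (J l))
  set V : ℝ → Plane := fun x => a + J x with hV
  have hVp : ∀ x ∈ Icc 0 l, V x = V 0 + ∫ s in (0 : ℝ)..x, v s := fun x _ => by
    simp [hV, hJ]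
  set f : ℝ → Plane := fun x => propagator h₁ h₂ x (V x) with hf
  have hfc : ContinuousOn f (Icc 0 l) := by
    have h1 := intervalIntegral.continuousOn_primitive_interval' hvi left_mem_uIcc
    rw [uIcc_of_le hl.le] at h1
    exact (continuous_propagator h₁ h₂).continuousOn.clm_apply (continuousOn_const.add h1)
  have hfm : MemLp f 2 (volume.restrict (Ioo 0 l)) := by
    obtain ⟨K, hK⟩ := isCompact_Icc.exists_bound_of_continuousOn hfc
    refine MemLp.of_bound ((hfc.mono Ioo_subset_Icc_self).aestronglyMeasurable measurableSet_Ioo)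
      K ?_
    filter_upwards [ae_restrict_mem measurableSet_Ioo] with s hs
    exact hK s (Ioo_subset_Icc_self hs)
  have hf0 : f 0 = a := by simp [hf, hV, hJ, propagator_zero]
  refine ⟨hfm.toLp, f l, f, (exchange h₁ h₂).compLp hfm.toLp - y, ⟨hfm.coeFn_toLp, ?_⟩,
    by simp, ?_, rfl⟩
  · intro x hx
    have h1 := propagator_primitive h₁ h₂ hvi hVp hx
    have h2 : V 0 = f 0 := by simp [hf, propagator_zero]
    rw [h2] at h1
    refine h1.trans ?_
    congr 1
    refine (State.integral_congr ?_ hx).symm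
    filter_upwards [Lp.coeFn_sub ((exchange h₁ h₂).compLp hfm.toLp) y,
      (exchange h₁ h₂).coeFn_compLp hfm.toLp, hfm.coeFn_toLp] with s e1 e2 e3
    rw [e1, Pi.sub_apply, e2, e3, hv]
    beta_reduce
    rw [map_neg, propagator_apply_neg, sub_eq_add_neg]
  · rw [hf0, hf]
    change a = roundTrip l h₁ h₂ k₁ k₂ (a + J l)
    rw [map_add, ← ha]
    abel

/-- The difference quotient is the time average of a continuous trajectory that starts at `y`. -/
lemma IsFeedbackFlow.tendsto_of_mem {l h₁ h₂ k₁ k₂ : ℝ} {S : ℝ → State l →L[ℝ] State l}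
    (hS : IsFeedbackFlow l h₁ h₂ k₁ k₂ S) (hl : 0 < l) {z y : State l}
    (hzy : (z, y) ∈ feedbackGraph l h₁ h₂ k₁ k₂) :
    Tendsto (fun t : ℝ => t⁻¹ • (S t z - z)) (𝓝[>] 0) (𝓝 y) := by
  have hc := (locL2_feedbackSignal h₁ h₂ k₁ k₂ hl y).continuous_traj l h₁ h₂
  have hd := (intervalIntegral.integral_hasDerivAt_right (hc.intervalIntegrable 0 0)
    (hc.stronglyMeasurableAtFilter _ _) hc.continuousAt).tendsto_slope_zero_right
  rw [traj_feedbackSignal_zero h₁ h₂ k₁ k₂ hl] at hd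
  refine hd.congr' ?_
  filter_upwards [self_mem_nhdsWithin] with t ht
  rw [hS.sub_eq_integral hl hzy (le_of_lt ht), zero_add, intervalIntegral.integral_same, sub_zero]

/-- For a decaying semigroup, only `0` has derivative `0` at time `0`. -/
lemma IsC0Semigroup.eq_zero_of_tendsto {X : Type*} [NormedAddCommGroup X] [NormedSpace ℝ X]
    {S : ℝ → X →L[ℝ] X} (hS : IsC0Semigroup S) {M γ₀ : ℝ} (hγ : 0 < γ₀)
    (hb : ∀ t, 0 ≤ t → ‖S t‖ ≤ M * Real.exp (-γ₀ * t)) {d : X}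
    (hd : Tendsto (fun t : ℝ => t⁻¹ • (S t d - d)) (𝓝[>] 0) (𝓝 0)) : d = 0 := by
  -- The right derivative of the orbit at time `s` is `S s` applied to that at `0`, hence zero. The
  -- orbit is constant, and decay forces it to vanish.
  have hconst : ∀ b, 0 ≤ b → S b d = d := by
    intro b hb'
    have h1 : ∀ x ∈ Icc 0 b, S x d = S 0 d := by
      refine constant_of_has_deriv_right_zero
        ((hS.continuousOn d).mono Icc_subset_Ici_self) fun s hs => ?_
      rw [← hasDerivWithinAt_Ioi_iff_Ici, hasDerivWithinAt_iff_tendsto_slope' (by simp)]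
      have h2 : Tendsto (fun t : ℝ => t - s) (𝓝[>] s) (𝓝[>] 0) := by
        refine tendsto_nhdsWithin_iff.2 ⟨?_, ?_⟩
        · have : Tendsto (fun t : ℝ => t - s) (𝓝 s) (𝓝 (s - s)) :=
            (continuous_id.sub continuous_const).tendsto s
          rw [sub_self] at this
          exact this.mono_left nhdsWithin_le_nhds
        · filter_upwards [self_mem_nhdsWithin] with t ht
          exact sub_pos.2 (mem_Ioi.1 ht)
      have h3 := ((S s).continuous.tendsto 0).comp (hd.comp h2)
      rw [map_zero] at h3
      refine h3.congr' ?_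
      filter_upwards [self_mem_nhdsWithin] with t ht
      have h4 := hS.add s (t - s) hs.1 (sub_nonneg.2 (le_of_lt ht))
      rw [add_sub_cancel] at h4
      simp only [Function.comp_apply, map_smul, map_sub, slope, vsub_eq_sub, h4]
      rfl
    rw [h1 b (right_mem_Icc.2 hb'), hS.zero]
    rfl
  have h2 : ∀ᶠ t : ℝ in atTop, ‖d‖ ≤ M * Real.exp (-γ₀ * t) * ‖d‖ := by
    filter_upwards [eventually_ge_atTop 0] with t ht
    conv_lhs => rw [← hconst t ht]
    exact ContinuousLinearMap.le_of_opNorm_le _ (hb t ht) _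
  have h3 : Tendsto (fun t : ℝ => M * Real.exp (-γ₀ * t) * ‖d‖) atTop (𝓝 (M * 0 * ‖d‖)) := by
    refine (Tendsto.const_mul M (Real.tendsto_exp_atBot.comp ?_)).mul_const _
    exact tendsto_id.const_mul_atTop_of_neg (neg_neg_of_pos hγ)
  have h4 := ge_of_tendsto h3 h2
  rw [mul_zero, zero_mul] at h4
  exact norm_le_zero_iff.1 h4

/-- The generator extends the feedback operator, which is onto, and has trivial kernel because the
semigroup decays; so the extension is not proper. -/
lemma IsFeedbackFlow.isGenerator {l h₁ h₂ k₁ k₂ : ℝ} {S : ℝ → State l →L[ℝ] State l}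
    (hS : IsFeedbackFlow l h₁ h₂ k₁ k₂ S) (hl : 0 < l) {M γ₀ : ℝ} (hγ : 0 < γ₀)
    (hb : ∀ t, 0 ≤ t → ‖S t‖ ≤ M * Real.exp (-γ₀ * t))
    (hG : ∀ b, ∃ a, a - roundTrip l h₁ h₂ k₁ k₂ a = b) :
    IsGenerator S (feedbackOp l h₁ h₂ k₁ k₂) := by
  intro z y
  rw [feedbackOp_graph]
  refine ⟨hS.tendsto_of_mem hl, fun h => ?_⟩
  obtain ⟨z', hz'⟩ := exists_mem_feedbackGraph hl hG y
  have h1 := h.sub (hS.tendsto_of_mem hl hz')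
  rw [sub_self] at h1
  have h2 : z - z' = 0 := by
    refine (hS.isC0Semigroup hl).eq_zero_of_tendsto hγ hb (h1.congr fun t => ?_)
    rw [← smul_sub, map_sub]
    congr 1
    abel
  rwa [sub_eq_zero.1 h2]

/-- The inverse of the generator is bounded. -/
lemma IsFeedbackFlow.exists_norm_le {l h₁ h₂ k₁ k₂ : ℝ} {S : ℝ → State l →L[ℝ] State l}
    (hS : IsFeedbackFlow l h₁ h₂ k₁ k₂ S) (hl : 0 < l) {M γ₀ : ℝ} (hγ : 0 < γ₀)
    (hb : ∀ t, 0 ≤ t → ‖S t‖ ≤ M * Real.exp (-γ₀ * t)) :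
    ∃ C : ℝ, 0 < C ∧ ∀ z y, (z, y) ∈ feedbackGraph l h₁ h₂ k₁ k₂ → ‖z‖ ≤ C * ‖y‖ := by
  have hM : 0 ≤ M := by
    have := (norm_nonneg _).trans (hb 0 le_rfl)
    simpa using this
  have hlim : Tendsto (fun t : ℝ => M * Real.exp (-γ₀ * t)) atTop (𝓝 (M * 0)) :=
    Tendsto.const_mul M (Real.tendsto_exp_atBot.comp
      (tendsto_id.const_mul_atTop_of_neg (neg_neg_of_pos hγ)))
  rw [mul_zero] at hlim
  -- At such a `T` the semigroup halves norms, so `‖z‖ ≤ ‖z‖ / 2 + M T ‖y‖`, which gives the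
  -- constant `2 M T`.
  obtain ⟨T, hT1, hT⟩ := ((hlim.eventually (gt_mem_nhds (show (0 : ℝ) < 1 / 2 by norm_num))).and
    (eventually_ge_atTop (0 : ℝ))).exists
  refine ⟨2 * (M * T) + 1, by positivity, fun z y hzy => ?_⟩
  have h1 := hS.sub_eq_integral hl hzy hT
  have h2 : ‖∫ s in (0 : ℝ)..T, traj l h₁ h₂ (feedbackSignal l h₁ h₂ k₁ k₂ y) s‖ ≤
      M * ‖y‖ * |T - 0| := by
    refine intervalIntegral.norm_integral_le_of_norm_le_const fun s hs => ?_
    rw [uIoc_of_le hT] at hs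
    rw [← hS.apply_eq hl y hs.1.le]
    refine (ContinuousLinearMap.le_of_opNorm_le _ (hb s hs.1.le) _).trans ?_
    gcongr
    refine mul_le_of_le_one_right hM (Real.exp_le_one_iff.2 ?_)
    nlinarith [hs.1]
  rw [← h1, sub_zero, abs_of_nonneg hT] at h2
  have h3 : ‖S T z‖ ≤ 1 / 2 * ‖z‖ :=
    (ContinuousLinearMap.le_of_opNorm_le _ (hb T hT) _).trans (by gcongr)
  have h4 : ‖z‖ ≤ ‖S T z‖ + ‖S T z - z‖ := by
    have := norm_sub_le (S T z) (S T z - z)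
    rwa [sub_sub_cancel] at this
  nlinarith [norm_nonneg y]

/-! ### The resonantly forced delay equation -/

/-- A delay equation that is forced by a solution of the unforced equation is solved by an
unforced solution plus a linearly growing multiple of the forcing. -/
lemma Returns.sub_smul_iff {G : Plane →L[ℝ] Plane} {l a : ℝ} {U W : ℝ → Plane}
    (hW : Returns G l a W) (σ : ℝ) :
    Returns G l a (fun s => U s - (σ * s) • W s) ↔
      ∀ᵐ s : ℝ, a < s → U s = G (U (s - l)) + (σ * l) • W s := by
  -- `G` maps `σ (s - l) W (s - l)` to `σ (s - l) W s`, which falls short of `σ s W s` by exactly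
  -- the forcing `σ l W s`.
  have key : ∀ s, W s = G (W (s - l)) → (U s - (σ * s) • W s =
      G (U (s - l) - (σ * (s - l)) • W (s - l)) ↔ U s = G (U (s - l)) + (σ * l) • W s) := by
    intro s hs
    rw [map_sub, map_smul, ← hs, sub_eq_iff_eq_add]
    have : G (U (s - l)) - (σ * (s - l)) • W s + (σ * s) • W s =
        G (U (s - l)) + (σ * l) • W s := by module
    rw [this]
  constructor
  · intro h
    filter_upwards [h, hW] with s h1 h2 hs
    exact (key s (h2 hs)).1 (h1 hs)
  · intro h
    filter_upwards [h, hW] with s h1 h2 hs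
    exact (key s (h2 hs)).2 (h1 hs)

/-- The unforced equation is solved with the resonant term subtracted from the data, and the term is
then added back. -/
lemma exists_forced_signal {G : Plane →L[ℝ] Plane} {l a : ℝ} (hl : 0 < l) {φ W : ℝ → Plane}
    (hφ : LocL2 φ) (hWL : LocL2 W) (hW : Returns G l a W) (σ : ℝ) :
    ∃ U : ℝ → Plane, LocL2 U ∧ (∀ s ≤ a, U s = φ s) ∧
      ∀ᵐ s : ℝ, a < s → U s = G (U (s - l)) + (σ * l) • W s := by
  have hc : Continuous fun s : ℝ => σ * s := by fun_prop
  set ψ : ℝ → Plane := fun s => φ s - (σ * s) • W s with hψ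
  refine ⟨fun s => renew G l a ψ s + (σ * s) • W s,
    ((hφ.sub (hWL.smul_fun hc)).renew G a hl).add (hWL.smul_fun hc), fun s hs => ?_, ?_⟩
  · beta_reduce
    rw [renew_of_le G hl ψ hs, hψ]
    exact sub_add_cancel _ _
  · rw [← hW.sub_smul_iff σ]
    simpa only [add_sub_cancel_right] using returns_renew G a hl ψ

/-- The input of a mild solution is square integrable only after its starting time, so the earlier
values must be discarded before gluing. -/
lemma LocL2.ite' {U u : ℝ → Plane} {a : ℝ} (hU : LocL2 U)
    (hu : ∀ b, a ≤ b → MemLp u 2 (volume.restrict (Ioc a b))) :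
    LocL2 (fun s => if s ≤ a then U s else u s) := by
  have h : LocL2 ((Ioi a).indicator u) := by
    intro c d
    rw [memLp_indicator_iff_restrict measurableSet_Ioi,
      Measure.restrict_restrict measurableSet_Ioi]
    refine (hu (max a d) (le_max_left _ _)).mono_measure (Measure.restrict_mono_set _ ?_)
    exact fun s hs => ⟨hs.1, hs.2.2.trans (le_max_right _ _)⟩
  convert hU.ite h a using 2 with s
  by_cases hs : s ≤ a
  · rw [if_pos hs, if_pos hs]
  · rw [if_neg hs, if_neg hs, indicator_of_mem (mem_Ioi.2 (not_le.1 hs))]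

/-! ### Signals of the predictor and existence of trajectories -/

/-- A mild solution on a half line has a signal. -/
lemma exists_signal {l h₁ h₂ a : ℝ} (hl : 0 < l) {z₀ : State l} {u : ℝ → Plane} {z : ℝ → State l}
    (h : ∀ T, a ≤ T → IsMildSolution l h₁ h₂ a T z₀ u z) :
    ∃ U : ℝ → Plane, LocL2 U ∧ (∀ s, a < s → U s = u s) ∧ traj l h₁ h₂ U a = z₀ ∧
      ∀ t, a ≤ t → z t = traj l h₁ h₂ U t := by
  set U : ℝ → Plane := fun s => if s ≤ a then history l h₁ h₂ a z₀ s else u s with hU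
  have hUL : LocL2 U := (locL2_history l h₁ h₂ a z₀).ite' fun b hb => (h b hb).input
  have hUu : ∀ s, a < s → U s = u s := fun s hs => if_neg (not_le.2 hs)
  have h0 : traj l h₁ h₂ U a = z₀ := traj_eq_of_history hUL fun s hs => if_pos hs.2.le
  exact ⟨U, hUL, hUu, h0, fun t ht => (h t ht).eq_traj hl.le hUL h0
    (Eventually.of_forall fun s hs => (hUu s hs.1).symm) (right_mem_Icc.2 ht)⟩

/-- The end value of a predictor whose signal switches from `P` to `Q` at time `t - τ`. -/
lemma ae_hasEndValue_switch {P Q : ℝ → Plane} (hP : LocL2 P) (hQ : LocL2 Q) {l τ : ℝ}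
    (hl : 0 < l) (hτ : 0 < τ) (h₁ h₂ : ℝ) :
    ∀ᵐ t : ℝ, HasEndValue l (traj l h₁ h₂ (fun r => if r ≤ t - τ then P r else Q r) t)
      (propagator h₁ h₂ l (if τ < l then P (t - l) else Q (t - l))) := by
  -- The switched signal changes with `t`, so end values of a fixed trajectory do not suffice. Near
  -- `x = l` the state is a wave of `P` or of `Q`, and the exceptional times of these two are
  -- independent of the switch.
  filter_upwards [hP.ae_hasEndValue l h₁ h₂, hQ.ae_hasEndValue l h₁ h₂] with t hp hq
  have h := (ae_restrict_iff' measurableSet_Ioo).1 ((hP.ite hQ (t - τ)).coeFn_traj l h₁ h₂ t)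
  by_cases hlt : τ < l
  · rw [if_pos hlt]
    refine hp _ ⟨τ, hlt, ?_⟩
    filter_upwards [h] with x hx hm
    rw [hx ⟨hτ.trans hm.1, hm.2⟩, if_pos (by linarith [hm.1])]
  · rw [if_neg hlt]
    refine hq _ ⟨0, hl, ?_⟩
    filter_upwards [h] with x hx hm
    rw [hx hm, if_neg (by linarith [hm.2])]

/-- A predictor inherits the observer signal through its initial state at `t - τ` and runs on the
actual control afterwards. -/
lemma IsMildSolution.eq_traj_switch {P Q u : ℝ → Plane} (hP : LocL2 P) (hQ : LocL2 Q)
    {l h₁ h₂ τ t : ℝ} (hl : 0 < l) (hτ : 0 < τ) {z : ℝ → State l}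
    (h : IsMildSolution l h₁ h₂ (t - τ) t (traj l h₁ h₂ P (t - τ)) u z)
    (hu : ∀ s, t - τ < s → Q s = u s) :
    z t = traj l h₁ h₂ (fun r => if r ≤ t - τ then P r else Q r) t := by
  refine h.eq_traj hl.le (hP.ite hQ (t - τ)) ?_ (Eventually.of_forall fun s hs => ?_)
    (right_mem_Icc.2 (by linarith))
  · exact traj_congr (hP.ite hQ _) hP (Eventually.of_forall fun s hs => if_pos hs.2.le)
  · rw [if_neg (not_le.2 hs.1), hu s hs.1]

lemma isMildSolution_switch {P Q u : ℝ → Plane} (hP : LocL2 P) (hQ : LocL2 Q)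
    {l h₁ h₂ τ t : ℝ} (hτ : 0 < τ) (hu : ∀ s, t - τ < s → Q s = u s) :
    IsMildSolution l h₁ h₂ (t - τ) t (traj l h₁ h₂ P (t - τ)) u
      (fun s => traj l h₁ h₂ (fun r => if r ≤ t - τ then P r else Q r) s) := by
  refine (hP.ite hQ (t - τ)).isMildSolution (fun _ _ => rfl) (by linarith) ?_
    (Eventually.of_forall fun s hs => ?_)
  · exact traj_congr (hP.ite hQ _) hP (Eventually.of_forall fun s hs => if_pos hs.2.le)
  · rw [if_neg (not_le.2 hs.1), hu s hs.1]

/-- The output swaps the two components just as the feedback does. The observer input is thus the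
control plus the feedback of the end value of the observer error, free of delay. -/
lemma observer_input_eq (k₁ k₂ : ℝ) (c d a y : Plane) (hy : y = !₂[d 1, d 0]) :
    !₂[-k₁ * (c 1 - y 0) + a 0, -k₂ * (c 0 - y 1) + a 1] = feedback k₁ k₂ (c - d) + a := by
  subst hy
  ext i
  fin_cases i <;> simp [feedback]

/-- The weight with which the observer error enters the plant: the prediction error reaches the
boundary only if the delay is shorter than the passage time. -/
def errorWeight (l τ : ℝ) : ℝ := if τ < l then l⁻¹ else 0

/-- Here `c` and `d` stand for the plant and error signals one passage ago. For `τ < l` the weight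
times `l` is `1`, and the error contributes its own next value `w`. -/
lemma roundTrip_switch {l τ : ℝ} (h₁ h₂ k₁ k₂ : ℝ) (hl : 0 < l) {c d w : Plane}
    (hw : w = roundTrip l h₁ h₂ k₁ k₂ d) :
    feedback k₁ k₂ (propagator h₁ h₂ l (if τ < l then c + d else c)) =
      roundTrip l h₁ h₂ k₁ k₂ c + (errorWeight l τ * l) • w := by
  rw [← roundTrip_apply, errorWeight]
  by_cases h : τ < l
  · rw [if_pos h, if_pos h, inv_mul_cancel₀ hl.ne', one_smul, map_add, hw]
  · rw [if_neg h, if_neg h, zero_mul, zero_smul, add_zero]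

/-- Existence of closed loop trajectories. -/
lemma exists_closedLoop {l h₁ h₂ k₁ k₂ τ : ℝ} (hl : 0 < l) (hτ : 0 < τ) (θ₀ θp₀ : State l) :
    ∃ θ u y θp θm, ClosedLoop l h₁ h₂ k₁ k₂ τ θ₀ θp₀ θ u y θp θm := by
  -- The error signal is autonomous. Solving for it before the plant signal `U`, and defining the
  -- observer signal as `U + W`, removes the circularity of the loop.
  set W := feedbackSignal l h₁ h₂ k₁ k₂ (θp₀ - θ₀) with hW
  have hWL : LocL2 W := locL2_feedbackSignal h₁ h₂ k₁ k₂ hl _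
  have hWR : Returns (roundTrip l h₁ h₂ k₁ k₂) l 0 W := returns_feedbackSignal h₁ h₂ k₁ k₂ hl _
  have hzero : LocL2 (0 : ℝ → Plane) := fun _ _ => MemLp.zero
  obtain ⟨U, hUL, hUτ, hUR⟩ := exists_forced_signal hl
    ((locL2_history l h₁ h₂ 0 θ₀).ite hzero 0) hWL (hWR.mono hτ.le) (errorWeight l τ)
  have hU0 : traj l h₁ h₂ U 0 = θ₀ := traj_eq_of_history hUL fun s hs => by
    rw [hUτ s (hs.2.le.trans hτ.le), if_pos hs.2.le]
  have hP : LocL2 fun s => U s + W s := hUL.add hWL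
  have hP0 : traj l h₁ h₂ (fun s => U s + W s) 0 = θp₀ := by
    rw [traj_add hUL hWL, hU0, hW, traj_feedbackSignal_zero h₁ h₂ k₁ k₂ hl, add_sub_cancel]
  have hev := hUL.ae_hasEndValue_traj hl h₁ h₂
  refine ⟨traj l h₁ h₂ U, U,
    fun t => !₂[propagator h₁ h₂ l (U (t - τ - l)) 1, propagator h₁ h₂ l (U (t - τ - l)) 0],
    traj l h₁ h₂ (fun s => U s + W s),
    fun s t => traj l h₁ h₂ (fun r => if r ≤ t - τ then U r + W r else U r) s, ?_⟩
  constructor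
  · exact fun T hT => hUL.isMildSolution (fun _ _ => rfl) hT hU0
      (Eventually.of_forall fun _ _ => rfl)
  · filter_upwards [(measurePreserving_sub_right volume τ).quasiMeasurePreserving.ae hev]
      with t ht _
    exact ⟨_, ht, rfl⟩
  · refine ⟨fun s => U s + W s, fun T hT => hP.isMildSolution (fun _ _ => rfl) hT hP0
      (Eventually.of_forall fun _ _ => rfl), ?_⟩
    filter_upwards [hP.ae_hasEndValue_traj hl h₁ h₂, hWR] with s hs hw hs0
    refine ⟨_, hs, ?_⟩
    have h := observer_input_eq k₁ k₂ (propagator h₁ h₂ l (U (s - l) + W (s - l)))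
      (propagator h₁ h₂ l (U (s - l))) (U s) !₂[propagator h₁ h₂ l (U (s + τ - τ - l)) 1,
        propagator h₁ h₂ l (U (s + τ - τ - l)) 0] (by rw [add_sub_cancel_right])
    rw [← map_sub, add_sub_cancel_left, ← roundTrip_apply, ← hw hs0, add_comm (W s)] at h
    exact h.symm
  · exact fun t ht => isMildSolution_switch hP hUL hτ fun _ _ => rfl
  · refine Eventually.of_forall fun t h0 ht => ?_
    rw [hUτ t ht]
    rcases h0.eq_or_lt with rfl | h0
    · rw [if_pos le_rfl, history, indicator_of_notMem (fun h => lt_irrefl _ h.2)]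
    · rw [if_neg (not_le.2 h0)]; rfl
  · filter_upwards [ae_hasEndValue_switch hP hUL hl hτ h₁ h₂, hUR, hWR] with t ht hu hw hτt
    refine ⟨_, ht, ?_⟩
    rw [hu hτt, roundTrip_switch h₁ h₂ k₁ k₂ hl (hw (hτ.trans hτt))]

/-- Existence of solutions of the error system. -/
lemma exists_errorSystem {l h₁ h₂ k₁ k₂ τ : ℝ} (hl : 0 < l) (hτ : 0 < τ) (z w : State l) :
    ∃ θ εp εm, ErrorSystem l h₁ h₂ k₁ k₂ τ w θ εp εm ∧ θ τ = z := by
  set W := feedbackSignal l h₁ h₂ k₁ k₂ w with hW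
  have hWL : LocL2 W := locL2_feedbackSignal h₁ h₂ k₁ k₂ hl _
  have hWR : Returns (roundTrip l h₁ h₂ k₁ k₂) l 0 W := returns_feedbackSignal h₁ h₂ k₁ k₂ hl _
  have hzero : LocL2 (fun _ => 0 : ℝ → Plane) := fun _ _ => MemLp.zero
  obtain ⟨U, hUL, hUτ, hUR⟩ := exists_forced_signal hl
    (locL2_history l h₁ h₂ τ z) hWL (hWR.mono hτ.le) (errorWeight l τ)
  refine ⟨traj l h₁ h₂ U, traj l h₁ h₂ W,
    fun s t => traj l h₁ h₂ (fun r => if r ≤ t - τ then W r else 0) s, ?_,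
    traj_eq_of_history hUL fun s hs => hUτ s hs.2.le⟩
  constructor
  · refine ⟨W, fun T hT => hWL.isMildSolution (fun _ _ => rfl) hT
      (traj_feedbackSignal_zero h₁ h₂ k₁ k₂ hl w) (Eventually.of_forall fun _ _ => rfl), ?_⟩
    filter_upwards [hWL.ae_hasEndValue_traj hl h₁ h₂, hWR] with s hs hw hs0
    exact ⟨_, hs, hw hs0⟩
  · exact fun t ht => isMildSolution_switch hWL hzero hτ fun _ _ => rfl
  · refine ⟨U, fun T hT => hUL.isMildSolution (fun _ _ => rfl) hT rfl
      (Eventually.of_forall fun _ _ => rfl), ?_⟩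
    filter_upwards [hUL.ae_hasEndValue_traj hl h₁ h₂, ae_hasEndValue_switch hWL hzero hl hτ h₁ h₂,
      hUR, hWR] with t h1 h2 h3 h4 ht
    refine ⟨_, _, h1, h2, ?_⟩
    have h5 := roundTrip_switch (τ := τ) h₁ h₂ k₁ k₂ hl (c := 0) (h4 (hτ.trans ht))
    rw [map_zero, zero_add, zero_add] at h5
    rw [h3 ht, h5, add_comm]
    rfl

/-! ### Estimates for forced and uncontrolled signals -/

lemma norm_traj_smul_le {W : ℝ → Plane} (hW : LocL2 W) {l : ℝ} (h₁ h₂ : ℝ) {σ : ℝ} (hσ : 0 ≤ σ)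
    {t : ℝ} (ht : 0 ≤ t) : ‖traj l h₁ h₂ (fun s => (σ * s) • W s) t‖ ≤
      σ * (t + l) * ‖traj l h₁ h₂ W t‖ := by
  refine Lp.norm_le_mul_norm_of_ae_le_mul ?_
  filter_upwards [(hW.smul_fun (φ := fun s => σ * s) (by fun_prop)).coeFn_traj l h₁ h₂ t,
    hW.coeFn_traj l h₁ h₂ t, ae_restrict_mem measurableSet_Ioo] with x e1 e2 hx
  rw [e1, e2, map_smul, norm_smul, Real.norm_eq_abs, abs_mul, abs_of_nonneg hσ]
  gcongr
  -- The state at time `t` reads the signal at times `t - x` in `(t - l, t)`, where `|t - x| ≤ t +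
  -- l`.
  rw [abs_le]
  constructor <;> linarith [hx.1, hx.2]

/-- Decay of a signal that is forced by the observer error. -/
lemma IsFeedbackFlow.norm_traj_le {l h₁ h₂ k₁ k₂ : ℝ} {S : ℝ → State l →L[ℝ] State l}
    (hS : IsFeedbackFlow l h₁ h₂ k₁ k₂ S) {M γ₀ : ℝ}
    (hb : ∀ t, 0 ≤ t → ‖S t‖ ≤ M * Real.exp (-γ₀ * t)) {U W : ℝ → Plane} (hU : LocL2 U)
    (hWL : LocL2 W) (hW : Returns (roundTrip l h₁ h₂ k₁ k₂) l 0 W) {σ τ : ℝ} (hσ : 0 ≤ σ)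
    (hτ : 0 ≤ τ)
    (hUR : ∀ᵐ s : ℝ, τ < s → U s = roundTrip l h₁ h₂ k₁ k₂ (U (s - l)) + (σ * l) • W s)
    {t : ℝ} (ht : τ ≤ t) :
    ‖traj l h₁ h₂ U t‖ ≤ M * Real.exp (-γ₀ * (t - τ)) * (‖traj l h₁ h₂ U τ‖ +
      σ * (τ + l) * ‖traj l h₁ h₂ W τ‖) + σ * (t + l) * ‖traj l h₁ h₂ W t‖ := by
  have hWs : LocL2 fun s => (σ * s) • W s := hWL.smul_fun (by fun_prop)
  have hV := hU.sub hWs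
  -- After `τ` the signal with the resonant term removed is unforced, so the semigroup moves it. The
  -- term is estimated separately at times `τ` and `t`.
  have h1 := hS _ hV τ (((hW.mono hτ).sub_smul_iff σ).2 hUR) t ht
  rw [traj_sub hU hWs, traj_sub hU hWs] at h1
  have h2 := norm_traj_smul_le hWL h₁ h₂ hσ (l := l) hτ
  have h3 := norm_traj_smul_le hWL h₁ h₂ hσ (l := l) (hτ.trans ht)
  have h4 := ContinuousLinearMap.le_of_opNorm_le _ (hb (t - τ) (sub_nonneg.2 ht))
    (traj l h₁ h₂ U τ - traj l h₁ h₂ (fun s => (σ * s) • W s) τ)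
  rw [← h1] at h4
  have h5 : 0 ≤ M * Real.exp (-γ₀ * (t - τ)) :=
    (norm_nonneg _).trans (hb (t - τ) (sub_nonneg.2 ht))
  have h6 := (norm_sub_le (traj l h₁ h₂ U τ) (traj l h₁ h₂ (fun s => (σ * s) • W s) τ)).trans
    (add_le_add_right h2 _)
  have h7 := norm_sub_norm_le (traj l h₁ h₂ U t) (traj l h₁ h₂ (fun s => (σ * s) • W s) t)
  have h8 := h4.trans (mul_le_mul_of_nonneg_left h6 h5)
  linarith

/-- Uncontrolled states are bounded by their initial states. -/
lemma exists_uncontrolled_bound {l : ℝ} (h₁ h₂ : ℝ) (hl : 0 < l) :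
    ∃ C : ℝ, 0 < C ∧ ∀ U : ℝ → Plane, LocL2 U → ∀ τ, 0 ≤ τ →
      (∀ᵐ s : ℝ, 0 ≤ s → s ≤ τ → U s = 0) →
      ‖traj l h₁ h₂ U τ‖ ≤ C * ‖traj l h₁ h₂ U 0‖ := by
  -- Zero inflow is the delay equation with `G = 0`. With `q = 1` the decay estimate becomes a bound
  -- uniform in time.
  obtain ⟨M, hM, h⟩ := exists_returns_decay (G := 0) (C := ‖(1 : Plane →L[ℝ] Plane)‖ + 1)
    (q := 1) h₁ h₂ hl (by positivity) one_pos (fun n => by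
      rcases n with _ | n
      · simp
      · rw [zero_pow n.succ_ne_zero, norm_zero]; positivity)
  refine ⟨M, hM, fun U hU τ hτ h0 => ?_⟩
  have hz : LocL2 (0 : ℝ → Plane) := fun _ _ => MemLp.zero
  -- The control vanishes only up to `τ`; cutting the signal off after `0` does not change the state
  -- at `τ`.
  have hV := hU.ite hz 0
  have h1 := h _ hV 0 (Eventually.of_forall fun s hs => by
    beta_reduce
    rw [if_neg (not_le.2 hs)]; rfl) τ hτ
  rw [one_pow, mul_one] at h1
  rw [traj_congr hV hU (h0.mono fun s hs hm => ?_),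
    traj_congr hV hU (Eventually.of_forall fun s hm => if_pos hm.2.le)] at h1
  · exact h1
  · by_cases hs0 : s ≤ 0
    · rw [if_pos hs0]
    · rw [if_neg hs0, hs (not_le.1 hs0).le hm.2.le]; rfl

/-! ### Reduction of given solutions to their signals -/

/-- The signals of a closed loop trajectory. -/
lemma ClosedLoop.exists_signals {l h₁ h₂ k₁ k₂ τ : ℝ} (hl : 0 < l) (hτ : 0 < τ)
    {θ₀ θp₀ : State l} {θ : ℝ → State l} {u y : ℝ → Plane} {θp : ℝ → State l}
    {θm : ℝ → ℝ → State l} (h : ClosedLoop l h₁ h₂ k₁ k₂ τ θ₀ θp₀ θ u y θp θm) :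
    ∃ U W : ℝ → Plane, LocL2 U ∧ LocL2 W ∧ Returns (roundTrip l h₁ h₂ k₁ k₂) l 0 W ∧
      (∀ᵐ s : ℝ, τ < s → U s = roundTrip l h₁ h₂ k₁ k₂ (U (s - l)) +
        (errorWeight l τ * l) • W s) ∧
      (∀ᵐ s : ℝ, 0 ≤ s → s ≤ τ → U s = 0) ∧ traj l h₁ h₂ U 0 = θ₀ ∧
      traj l h₁ h₂ W 0 = θp₀ - θ₀ ∧ ∀ t, 0 ≤ t → θ t = traj l h₁ h₂ U t := by
  obtain ⟨U, hUL, hUu, hU0, hUθ⟩ := exists_signal hl h.plant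
  obtain ⟨v, hv, hvc⟩ := h.observer
  obtain ⟨P, hPL, hPv, hP0, hPθ⟩ := exists_signal hl hv
  -- The observation at time `s + τ` is the end value of the plant at time `s`, so the difference of
  -- observer and plant signals obeys the undelayed law.
  have hWR : Returns (roundTrip l h₁ h₂ k₁ k₂) l 0 (fun s => P s - U s) := by
    filter_upwards [hvc, (measurePreserving_add_right volume τ).quasiMeasurePreserving.ae
      h.observation, hUL.ae_hasEndValue_traj hl h₁ h₂, hPL.ae_hasEndValue_traj hl h₁ h₂]
      with s h1 h2 h3 h4 hs
    obtain ⟨c, hc, hvs⟩ := h1 hs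
    obtain ⟨d, hd, hys⟩ := h2 (by linarith)
    rw [add_sub_cancel_right, hUθ s hs.le] at hd
    rw [hPθ s hs.le] at hc
    rw [hPv s hs, hUu s hs, hvs, observer_input_eq k₁ k₂ c d (u s) _ hys, add_sub_cancel_right,
      hc.unique h4, hd.unique h3, ← map_sub, roundTrip_apply]
  refine ⟨U, fun s => P s - U s, hUL, hPL.sub hUL, hWR, ?_, ?_, hU0,
    by rw [traj_sub hPL hUL, hP0, hU0], hUθ⟩
  · filter_upwards [h.control_after, ae_hasEndValue_switch hPL hUL hl hτ h₁ h₂, hWR]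
      with t h1 h2 h3 ht
    obtain ⟨c, hc, hut⟩ := h1 ht
    have hp := h.predictor t ht
    rw [hPθ (t - τ) (by linarith)] at hp
    rw [hp.eq_traj_switch hPL hUL hl hτ fun s hs => hUu s (by linarith)] at hc
    have h5 := roundTrip_switch (τ := τ) h₁ h₂ k₁ k₂ hl (c := U (t - l)) (h3 (hτ.trans ht))
    rw [add_sub_cancel, ← hc.unique h2, ← hut, ← hUu t (hτ.trans ht)] at h5
    exact h5
  · have hne : ∀ᵐ s : ℝ, s ≠ 0 := compl_mem_ae_iff.2 (measure_singleton 0)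
    filter_upwards [h.control_before, hne] with s hs hs0 h0 hsτ
    rw [hUu s (lt_of_le_of_ne h0 hs0.symm), hs h0 hsτ]

/-- The signals of a solution of the error system. -/
lemma ErrorSystem.exists_signals {l h₁ h₂ k₁ k₂ τ : ℝ} (hl : 0 < l) (hτ : 0 < τ)
    {w : State l} {θ εp : ℝ → State l} {εm : ℝ → ℝ → State l}
    (h : ErrorSystem l h₁ h₂ k₁ k₂ τ w θ εp εm) :
    ∃ U W : ℝ → Plane, LocL2 U ∧ LocL2 W ∧ Returns (roundTrip l h₁ h₂ k₁ k₂) l 0 W ∧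
      (∀ᵐ s : ℝ, τ < s → U s = roundTrip l h₁ h₂ k₁ k₂ (U (s - l)) +
        (errorWeight l τ * l) • W s) ∧ ∀ t, τ ≤ t → θ t = traj l h₁ h₂ U t := by
  have hzero : LocL2 (fun _ => 0 : ℝ → Plane) := fun _ _ => MemLp.zero
  obtain ⟨v, hv, hvc⟩ := h.observerError
  obtain ⟨W, hWL, hWv, hW0, hWε⟩ := exists_signal hl hv
  obtain ⟨u, hu, huc⟩ := h.state
  obtain ⟨U, hUL, hUu, hU0, hUθ⟩ := exists_signal hl hu
  have hWR : Returns (roundTrip l h₁ h₂ k₁ k₂) l 0 W := by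
    filter_upwards [hvc, hWL.ae_hasEndValue_traj hl h₁ h₂] with s h1 h2 hs
    obtain ⟨c, hc, hvs⟩ := h1 hs
    rw [hWε s hs.le] at hc
    rw [hWv s hs, hvs, hc.unique h2, roundTrip_apply]
  refine ⟨U, W, hUL, hWL, hWR, ?_, hUθ⟩
  filter_upwards [huc, hUL.ae_hasEndValue_traj hl h₁ h₂,
    ae_hasEndValue_switch hWL hzero hl hτ h₁ h₂, hWR] with t h1 h2 h3 h4 ht
  obtain ⟨c, e, hc, he, hut⟩ := h1 ht
  have hp := h.predictorError t ht
  rw [hWε (t - τ) (by linarith)] at hp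
  rw [hp.eq_traj_switch hWL hzero hl hτ fun s hs => rfl] at he
  rw [hUθ t ht.le] at hc
  have h5 := roundTrip_switch (τ := τ) h₁ h₂ k₁ k₂ hl (c := 0) (h4 (hτ.trans ht))
  rw [map_zero, zero_add, zero_add] at h5
  rw [hUu t ht, hut, hc.unique h2, he.unique h3, h5, add_comm]
  rfl

/-! ### Decay for long and for short delays -/

lemma errorWeight_nonneg {l : ℝ} (hl : 0 < l) (τ : ℝ) : 0 ≤ errorWeight l τ := by
  unfold errorWeight; split_ifs <;> positivity

lemma errorWeight_le {l : ℝ} (hl : 0 < l) (τ : ℝ) : errorWeight l τ ≤ l⁻¹ := by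
  unfold errorWeight; split_ifs
  · exact le_rfl
  · positivity

lemma errorWeight_of_le {l τ : ℝ} (h : l ≤ τ) : errorWeight l τ = 0 := if_neg (not_lt.2 h)

end

theorem theorem1p1 (l h₁ h₂ k₁ k₂ τ : ℝ) (hl : 0 < l) (hh₁ : 0 < h₁) (hh₂ : 0 < h₂)
    (hk₁ : 0 < k₁) (hk₁' : k₁ < Real.sqrt (h₁ / h₂))
    (hk₂ : 0 < k₂) (hk₂' : k₂ < Real.sqrt (h₂ / h₁)) (hτ : 0 < τ) :
    -- the closed loop and the error system have solutions for all initial values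
    (∀ θ₀ θp₀ : State l, ∃ θ u y θp θm, ClosedLoop l h₁ h₂ k₁ k₂ τ θ₀ θp₀ θ u y θp θm) ∧
    (∀ z w : State l, ∃ θ εp εm, ErrorSystem l h₁ h₂ k₁ k₂ τ w θ εp εm ∧ θ τ = z) ∧
    -- the feedback operator generates an exponentially stable semigroup
    ∃ S : ℝ → State l →L[ℝ] State l, IsC0Semigroup S ∧
      IsGenerator S (feedbackOp l h₁ h₂ k₁ k₂) ∧
      (∃ M γ₀ : ℝ, 0 < M ∧ 0 < γ₀ ∧ ∀ t, 0 ≤ t → ‖S t‖ ≤ M * Real.exp (-γ₀ * t)) ∧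
      -- decay of the closed loop, for each decay rate `γ₀` of the semigroup
      ∀ M γ₀ : ℝ, 0 < γ₀ → (∀ t, 0 ≤ t → ‖S t‖ ≤ M * Real.exp (-γ₀ * t)) →
        (l < τ →
          (∃ D : ℝ, 0 < D ∧ ∀ θ₀ θp₀ θ u y θp θm,
            ClosedLoop l h₁ h₂ k₁ k₂ τ θ₀ θp₀ θ u y θp θm →
            ∀ t, τ < t → ‖θ t‖ ≤ D * Real.exp (-γ₀ * t) * ‖θ₀‖) ∧
          (∃ D : ℝ, 0 < D ∧ ∀ w θ εp εm, ErrorSystem l h₁ h₂ k₁ k₂ τ w θ εp εm →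
            ∀ t, τ < t → ‖θ t‖ ≤ D * Real.exp (-γ₀ * t) * ‖θ τ‖)) ∧
        (τ ≤ l → ∀ γ : ℝ, γ < γ₀ → ∃ D C : ℝ, 0 < D ∧ 0 < C ∧
          ∀ θ₀ θp₀ θ u y θp θm, ClosedLoop l h₁ h₂ k₁ k₂ τ θ₀ θp₀ θ u y θp θm →
          ∀ w : (feedbackOp l h₁ h₂ k₁ k₂).domain, (w : State l) = θp₀ - θ₀ →
          ∀ t, τ < t → ‖θ t‖ ≤ D * Real.exp (-γ * t) *
            (‖θ₀‖ + C * ‖feedbackOp l h₁ h₂ k₁ k₂ w‖)) := by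
  refine ⟨exists_closedLoop hl hτ, exists_errorSystem hl hτ, ?_⟩
  obtain ⟨S, hS, M₁, γ₁, hM₁, hγ₁, hb₁⟩ := exists_feedbackFlow hl hh₁ hh₂ hk₁ hk₁' hk₂ hk₂'
  obtain ⟨_, q, _, hq, hq1, hG⟩ := exists_roundTrip_pow_le hl hh₁ hh₂ hk₁ hk₁' hk₂ hk₂'
  refine ⟨S, hS.isC0Semigroup hl, hS.isGenerator hl hγ₁ hb₁ (exists_sub_roundTrip hq hq1 hG),
    ⟨M₁, γ₁, hM₁, hγ₁, hb₁⟩, fun M γ₀ hγ₀ hb => ?_⟩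
  have hM : 0 ≤ M := by
    have := (norm_nonneg _).trans (hb 0 le_rfl)
    simpa using this
  obtain ⟨C₀, hC₀, hfree⟩ := exists_uncontrolled_bound h₁ h₂ hl
  have hexp : ∀ t, Real.exp (-γ₀ * (t - τ)) = Real.exp (γ₀ * τ) * Real.exp (-γ₀ * t) := fun t => by
    rw [← Real.exp_add]; congr 1; ring
  -- This brings a sum into the form `D (x + C y)` with `D = a + 1` and `C = b + 1` positive.
  have haux : ∀ a b x y : ℝ, 0 ≤ a → 0 ≤ b → 0 ≤ x → 0 ≤ y →
      a * x + b * y ≤ (a + 1) * x + (a + 1) * (b + 1) * y := by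
    intro a b x y ha hb hx hy
    have h1 : 0 ≤ a * b * y := by positivity
    have h2 : 0 ≤ a * y := by positivity
    linarith
  refine ⟨fun hlτ => ⟨⟨M * Real.exp (γ₀ * τ) * C₀ + 1, by positivity, ?_⟩,
    ⟨M * Real.exp (γ₀ * τ) + 1, by positivity, ?_⟩⟩, fun hτl γ hγ => ?_⟩
  · intro θ₀ θp₀ θ u y θp θm h t ht
    obtain ⟨U, W, hUL, hWL, hWR, hUR, hUz, hU0, -, hUθ⟩ := h.exists_signals hl hτ
    have h1 := hS.norm_traj_le hb hUL hWL hWR (errorWeight_nonneg hl τ) hτ.le hUR ht.le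
    -- For a delay beyond the passage time the weight is zero, so the observer error disappears from
    -- the estimate.
    rw [errorWeight_of_le hlτ.le, zero_mul, zero_mul, zero_mul, zero_mul, add_zero, add_zero,
      hexp] at h1
    have h2 := hfree U hUL τ hτ.le hUz
    rw [hU0] at h2
    rw [hUθ t (hτ.le.trans ht.le)]
    refine h1.trans ?_
    calc M * (Real.exp (γ₀ * τ) * Real.exp (-γ₀ * t)) * ‖traj l h₁ h₂ U τ‖
        ≤ M * (Real.exp (γ₀ * τ) * Real.exp (-γ₀ * t)) * (C₀ * ‖θ₀‖) := by gcongr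
      _ = M * Real.exp (γ₀ * τ) * C₀ * Real.exp (-γ₀ * t) * ‖θ₀‖ := by ring
      _ ≤ _ := by gcongr; linarith
  · intro w θ εp εm h t ht
    obtain ⟨U, W, hUL, hWL, hWR, hUR, hUθ⟩ := h.exists_signals hl hτ
    have h1 := hS.norm_traj_le hb hUL hWL hWR (errorWeight_nonneg hl τ) hτ.le hUR ht.le
    rw [errorWeight_of_le hlτ.le, zero_mul, zero_mul, zero_mul, zero_mul, add_zero, add_zero,
      hexp, ← mul_assoc] at h1
    rw [hUθ t ht.le, hUθ τ le_rfl]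
    refine h1.trans ?_
    gcongr
    linarith
  · obtain ⟨C₁, hC₁, hinv⟩ := hS.exists_norm_le hl hγ₀ hb
    set δ := γ₀ - γ with hδ
    have hδ0 : 0 < δ := sub_pos.2 hγ
    set K₁ := M * Real.exp (γ₀ * τ) * C₀ with hK₁
    set K₂ := (M * Real.exp (γ₀ * τ) * (l⁻¹ * (τ + l) * M) + l⁻¹ * (δ⁻¹ + l) * M) * C₁ with hK₂
    have hK₁0 : 0 ≤ K₁ := by positivity
    have hK₂0 : 0 ≤ K₂ := by positivity
    refine ⟨K₁ + 1, K₂ + 1, by positivity, by positivity, ?_⟩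
    intro θ₀ θp₀ θ u y θp θm h w hw t ht
    have ht0 : 0 ≤ t := hτ.le.trans ht.le
    obtain ⟨U, W, hUL, hWL, hWR, hUR, hUz, hU0, hW0, hUθ⟩ := h.exists_signals hl hτ
    have hσ := errorWeight_nonneg hl τ
    have hσ' := errorWeight_le hl τ
    have h1 := hS.norm_traj_le hb hUL hWL hWR hσ hτ.le hUR ht.le
    rw [hexp] at h1
    have h2 := hfree U hUL τ hτ.le hUz
    rw [hU0] at h2
    have hgraph : ((w : State l), feedbackOp l h₁ h₂ k₁ k₂ w) ∈ feedbackGraph l h₁ h₂ k₁ k₂ := by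
      rw [← feedbackOp_graph]
      exact LinearPMap.mem_graph _ w
    have h3 := hinv _ _ hgraph
    set A := ‖feedbackOp l h₁ h₂ k₁ k₂ w‖ with hA
    have hA0 : 0 ≤ A := norm_nonneg _
    -- The error signal starts from `w`, whose norm is at most `C₁ * A` by the bounded inverse of
    -- the generator.
    have h4 : ∀ s, 0 ≤ s → ‖traj l h₁ h₂ W s‖ ≤ M * Real.exp (-γ₀ * s) * (C₁ * A) := by
      intro s hs
      rw [hS W hWL 0 hWR s hs, hW0, ← hw, sub_zero]
      exact (ContinuousLinearMap.le_of_opNorm_le _ (hb s hs) _).trans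
        (mul_le_mul_of_nonneg_left h3 (by positivity))
    have h5 : ‖traj l h₁ h₂ W τ‖ ≤ M * (C₁ * A) := by
      refine (h4 τ hτ.le).trans ?_
      gcongr
      refine mul_le_of_le_one_right hM (Real.exp_le_one_iff.2 ?_)
      nlinarith
    have hle : Real.exp (-γ₀ * t) ≤ Real.exp (-γ * t) := by
      refine Real.exp_le_exp.2 ?_
      nlinarith
    -- The linear growth from resonance is paid for by the gap `δ = γ₀ - γ`, through `δ t ≤ exp (δ
    -- t)`.
    have hpoly : (t + l) * Real.exp (-γ₀ * t) ≤ (δ⁻¹ + l) * Real.exp (-γ * t) := by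
      have e1 : t ≤ δ⁻¹ * Real.exp (δ * t) := by
        rw [inv_mul_eq_div, le_div_iff₀ hδ0]
        linarith [Real.add_one_le_exp (δ * t)]
      have e2 : Real.exp (δ * t) * Real.exp (-γ₀ * t) = Real.exp (-γ * t) := by
        rw [← Real.exp_add]; congr 1; rw [hδ]; ring
      calc (t + l) * Real.exp (-γ₀ * t)
          ≤ (δ⁻¹ * Real.exp (δ * t)) * Real.exp (-γ₀ * t) + l * Real.exp (-γ * t) := by
            rw [add_mul]; gcongr
        _ = _ := by rw [mul_assoc, e2]; ring
    rw [hUθ t ht0]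
    refine h1.trans ?_
    calc M * (Real.exp (γ₀ * τ) * Real.exp (-γ₀ * t)) * (‖traj l h₁ h₂ U τ‖ +
          errorWeight l τ * (τ + l) * ‖traj l h₁ h₂ W τ‖) +
          errorWeight l τ * (t + l) * ‖traj l h₁ h₂ W t‖
        ≤ M * (Real.exp (γ₀ * τ) * Real.exp (-γ * t)) * (C₀ * ‖θ₀‖ +
          l⁻¹ * (τ + l) * (M * (C₁ * A))) +
          l⁻¹ * (t + l) * (M * Real.exp (-γ₀ * t) * (C₁ * A)) := by
          gcongr
          exact h4 t ht0
      _ = M * (Real.exp (γ₀ * τ) * Real.exp (-γ * t)) * (C₀ * ‖θ₀‖ +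
          l⁻¹ * (τ + l) * (M * (C₁ * A))) +
          l⁻¹ * ((t + l) * Real.exp (-γ₀ * t)) * (M * (C₁ * A)) := by ring
      _ ≤ M * (Real.exp (γ₀ * τ) * Real.exp (-γ * t)) * (C₀ * ‖θ₀‖ +
          l⁻¹ * (τ + l) * (M * (C₁ * A))) +
          l⁻¹ * ((δ⁻¹ + l) * Real.exp (-γ * t)) * (M * (C₁ * A)) := by gcongr
      _ = Real.exp (-γ * t) * (K₁ * ‖θ₀‖ + K₂ * A) := by rw [hK₁, hK₂]; ring
      _ ≤ Real.exp (-γ * t) * ((K₁ + 1) * ‖θ₀‖ + (K₁ + 1) * (K₂ + 1) * A) := by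
          refine mul_le_mul_of_nonneg_left ?_ (Real.exp_pos _).le
          exact haux _ _ _ _ hK₁0 hK₂0 (norm_nonneg _) hA0
      _ = _ := by ring
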